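/- Let $(M^3,g)$ and $(N^2,h)$ be smooth Riemannian manifolds of dimensions $3$ and $2$, and let $\varphi:(M,g)\to(N,h)$ be a smooth semi-conformal submersion with dilation $\lambda:M\to(0,\infty)$: the differential $d\varphi_x$ is surjective for every $x\in M$ and $\lambda(x)^2g(X,Y)=h(d\varphi(X),d\varphi(Y))$ for all $X,Y\in\mathcal H_x:=(\ker d\varphi_x)^{\perp}$. Write $\mathcal V=\ker d\varphi$, and use $\mathcal V,\mathcal H$ also for the orthogonal projections. Let $U$ be a smooth unit vertical vector field ($d\varphi(U)=0$, $g(U,U)=1$), defined on an open set $W\subseteq M$. On $W$ put - $\theta=g(U,\cdot)$ and $\Omega=d\theta$, where $d\theta(X,Y)=X(\theta(Y))-Y(\theta(X))-\theta([X,Y])$; - $I(X,Y)=\mathcal V[X,Y]$ for horizontal $X,Y$, and $\|I\|^2=\sum_{a,b=1}^{2}|I(e_a,e_b)|^2$ for an orthonormal frame $\{e_1,e_2\}$ of $\mathcal H$; - $\mu=\mathcal H\nabla_UU$, the mean curvature vector field of the fibres, and $\mu^\flat=g(\mu,\cdot)$; - $d^{\mathcal V}f=U(f)\,\theta$ for a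 function $f$; $\omega\odot\eta=\frac12(\omega\otimes\eta+\eta\otimes\omega)$ and $\omega^2=\omega\otimes\omega$ for $1$-forms $\omega,\eta$; - $(d^*\Omega)(X)=-\sum_{i=1}^{3}(\nabla_{e_i}\Omega)(e_i,X)$ for an orthonormal frame $\{e_i\}$ of $TM$, and $\Delta f=\operatorname{trace}_g\nabla df$. Let $K^N$ be the Gauss curvature of $(N,h)$ (evaluated at $\varphi(x)$ in the formula below), let $\mathcal L$ denote the Lie derivative, and let the Ricci tensor be $\operatorname{Ricci}(X,Y)=\operatorname{trace}(Z\mapsto R(Z,X)Y)$ with $R(X,Y)=[\nabla_X,\nabla_Y]-\nabla_{[X,Y]}$. Then, at every point of $W$, $$ \begin{aligned} \operatorname{Ricci}(g)={}&\left\{\lambda^2K^N+\Delta\ln\lambda+\mu(\ln\lambda)\right\}(g-\theta^2)-\tfrac14\|I\|^2g+\tfrac12\mathcal L_\mu g\\ &-(\mu^\flat+d^{\mathcal V}\ln\lambda)^2-(d^{\mathcal V}\ln\lambda)^2+2\,d(U(\ln\lambda))\odot\theta+d^*\Omega\odot\theta . \end{aligned} $$ -/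

import Mathlib

open scoped Manifold ContDiff

noncomputable section

namespace SemiConformal

/-- The coordinate space `ℝⁿ`. -/
abbrev E (n : ℕ) : Type := EuclideanSpace ℝ (Fin n)

/-! ### Riemannian geometry in local coordinates

A metric in local coordinates is a function `G`, where `G y u v` is the value at the point `y` of the
metric on the coordinate vectors `u`, `v`. Vector fields, functions, `1`-forms and `2`-forms are
functions `X : E n → E n`, `f : E n → ℝ`, `α : E n → E n → ℝ` and `β : E n → E n → E n → ℝ`, the
first argument being the point. All the notions below depend only on the germs at the point. -/

section Coordinates

variable {n : ℕ}

/-- The `i`-th coordinate vector `∂ᵢ`. -/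
def coordVec (i : Fin n) : E n := EuclideanSpace.single i 1

/-- The matrix `(g_{ij})` of the metric at `y`. -/
def gram (G : E n → E n → E n → ℝ) (y : E n) : Matrix (Fin n) (Fin n) ℝ :=
  Matrix.of fun i j => G y (coordVec i) (coordVec j)

/-- The trace `g^{ij} B(∂ᵢ, ∂ⱼ)` with respect to the metric at `y` of a bilinear form `B`, that is
`∑ B(eᵢ, eᵢ)` over an orthonormal basis. -/
def metricTrace (G : E n → E n → E n → ℝ) (y : E n) (B : E n → E n → ℝ) : ℝ :=
  ∑ i, ∑ j, (gram G y)⁻¹ i j * B (coordVec i) (coordVec j)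

/-- The vector `α^♯ = g^{ij} α(∂ⱼ) ∂ᵢ` dual to a covector `α` with respect to the metric at `y`. -/
def sharp (G : E n → E n → E n → ℝ) (y : E n) (α : E n → ℝ) : E n :=
  ∑ i, ∑ j, ((gram G y)⁻¹ i j * α (coordVec j)) • coordVec i

/-- The Christoffel symbols: `christoffel G y (∂ᵢ) (∂ⱼ) = Γᵏᵢⱼ(y) ∂ₖ`, where
`Γᵏᵢⱼ = ½ gᵏˡ (∂ᵢ g_{jl} + ∂ⱼ g_{il} - ∂ₗ g_{ij})`. -/
def christoffel (G : E n → E n → E n → ℝ) (y u v : E n) : E n :=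
  sharp G y fun w => (1 / 2) *
    (fderiv ℝ (fun z => G z v w) y u + fderiv ℝ (fun z => G z u w) y v
      - fderiv ℝ (fun z => G z u v) y w)

/-- The Levi-Civita covariant derivative `(∇_u Y)(y)`. -/
def cov (G : E n → E n → E n → ℝ) (Y : E n → E n) (y u : E n) : E n :=
  fderiv ℝ Y y u + christoffel G y u (Y y)

/-- The Riemann curvature `R(u, v)w = ∇_u ∇_v w - ∇_v ∇_u w` at `y`, where the vectors are extended
with constant coefficients (so that their brackets vanish). -/
def curvature (G : E n → E n → E n → ℝ) (y u v w : E n) : E n :=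
  cov G (fun z => christoffel G z v w) y u - cov G (fun z => christoffel G z u w) y v

/-- The Ricci tensor at `y`: `Ric(v, w)` is the trace of `u ↦ R(u, v)w`. -/
def ricci (G : E n → E n → E n → ℝ) (y v w : E n) : ℝ :=
  ∑ i, curvature G y (coordVec i) v w i

/-- The Gauss curvature of a surface at `y`: `g(R(∂₁, ∂₂)∂₂, ∂₁) / (g₁₁ g₂₂ - g₁₂²)`. -/
def gaussCurvature (G : E 2 → E 2 → E 2 → ℝ) (y : E 2) : ℝ :=
  G y (curvature G y (coordVec 0) (coordVec 1) (coordVec 1)) (coordVec 0) / (gram G y).det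

/-- The derivative `X(f)` of the function `f` along the vector field `X`. -/
def dirDeriv (X : E n → E n) (f : E n → ℝ) (y : E n) : ℝ := fderiv ℝ f y (X y)

/-- The Laplacian `Δ f = trace ∇df`, where `∇df(u, v) = u(v(f)) - (∇_u v)(f)`. -/
def laplacian (G : E n → E n → E n → ℝ) (f : E n → ℝ) (y : E n) : ℝ :=
  metricTrace G y fun u v =>
    fderiv ℝ (fun z => fderiv ℝ f z v) y u - fderiv ℝ f y (christoffel G y u v)

/-- The Lie derivative `(𝓛_X g)(u, v)` of the metric at `y`. -/
def lieDerivMetric (G : E n → E n → E n → ℝ) (X : E n → E n) (y u v : E n) : ℝ :=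
  fderiv ℝ (fun z => G z u v) y (X y) + G y (fderiv ℝ X y u) v + G y u (fderiv ℝ X y v)

/-- The `1`-form `X^♭ = g(X, ·)`. -/
def flat (G : E n → E n → E n → ℝ) (X : E n → E n) (y u : E n) : ℝ := G y (X y) u

/-- The exterior derivative of a `1`-form, with the convention
`dα(X, Y) = X(α(Y)) - Y(α(X)) - α([X, Y])`. -/
def extDeriv (α : E n → E n → ℝ) (y u v : E n) : ℝ :=
  fderiv ℝ (fun z => α z v) y u - fderiv ℝ (fun z => α z u) y v

/-- The covariant derivative `(∇_u β)(v, w)` of a `2`-form at `y`. -/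
def covTwoForm (G : E n → E n → E n → ℝ) (β : E n → E n → E n → ℝ) (y u v w : E n) : ℝ :=
  fderiv ℝ (fun z => β z v w) y u - β y (christoffel G y u v) w - β y v (christoffel G y u w)

/-- The codifferential of a `2`-form: `(d^*β)(w) = - ∑ (∇_{eᵢ} β)(eᵢ, w)` over an orthonormal
basis. -/
def codiff (G : E n → E n → E n → ℝ) (β : E n → E n → E n → ℝ) (y w : E n) : ℝ :=
  - metricTrace G y fun u v => covTwoForm G β y u v w

/-! For a vector field `V` with `g(V, V) = 1`, spanning the vertical distribution: -/

/-- The orthogonal projection `𝓥 u` of `u` to the line spanned by the unit vector `V y`. -/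
def vert (G : E n → E n → E n → ℝ) (V : E n → E n) (y u : E n) : E n := G y u (V y) • V y

/-- The orthogonal projection `𝓗 u` of `u` to the orthogonal complement of `V y`. -/
def horiz (G : E n → E n → E n → ℝ) (V : E n → E n) (y u : E n) : E n := u - vert G V y u

/-- The mean curvature vector field `μ = 𝓗 ∇_V V` of the integral curves of `V`. -/
def meanCurvature (G : E n → E n → E n → ℝ) (V : E n → E n) (y : E n) : E n :=
  horiz G V y (cov G V y (V y))

/-- The integrability tensor of the horizontal distribution: `I(u, v) = 𝓥 [𝓗 u, 𝓗 v]`. It is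
`𝓥 [X, Y]` for horizontal fields with values `u`, `v` at `y`, and it vanishes when `u` or `v` is
vertical. -/
def integrability (G : E n → E n → E n → ℝ) (V : E n → E n) (y u v : E n) : E n :=
  vert G V y (VectorField.lieBracket ℝ (fun z => horiz G V z u) (fun z => horiz G V z v) y)

/-- The squared norm `‖I‖² = ∑ |I(e_a, e_b)|²`, the sum being over all pairs `(a, b)` of indices of
an orthonormal frame. -/
def integrabilityNormSq (G : E n → E n → E n → ℝ) (V : E n → E n) (y : E n) : ℝ :=
  metricTrace G y fun u u' => metricTrace G y fun v v' =>
    G y (integrability G V y u v) (integrability G V y u' v')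

end Coordinates

/-! ### Manifolds -/

section Manifolds

/-- A smooth Riemannian metric on an `n`-manifold. -/
abbrev Metric (n : ℕ) (M : Type*) [TopologicalSpace M] [ChartedSpace (E n) M]
    [IsManifold 𝓘(ℝ, E n) ∞ M] :=
  Bundle.ContMDiffRiemannianMetric 𝓘(ℝ, E n) ∞ (E n)
    (fun x : M => TangentSpace 𝓘(ℝ, E n) x)

variable {n : ℕ} {M : Type*} [TopologicalSpace M] [ChartedSpace (E n) M]

/-- The metric `g` read in the chart `e`. -/
def metricInChart [IsManifold 𝓘(ℝ, E n) ∞ M] (g : Metric n M) (e : OpenPartialHomeomorph M (E n))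
    (y u v : E n) : ℝ :=
  g.inner (e.symm y) (mfderiv 𝓘(ℝ, E n) 𝓘(ℝ, E n) e.symm y u)
    (mfderiv 𝓘(ℝ, E n) 𝓘(ℝ, E n) e.symm y v)

/-- The vector field `X` read in the chart `e`. -/
def fieldInChart (e : OpenPartialHomeomorph M (E n)) (X : ∀ x : M, TangentSpace 𝓘(ℝ, E n) x) :
    E n → E n :=
  VectorField.mpullback 𝓘(ℝ, E n) 𝓘(ℝ, E n) e.symm X

/-- `φ : (M, g) → (N, h)` is a smooth semi-conformal submersion with dilation `lam > 0`: its
differential is surjective at each point, and `lam² g(X, Y) = h(dφ X, dφ Y)` for all horizontal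
vectors `X`, `Y`, i.e. for all `X`, `Y` orthogonal to the kernel of `dφ`. -/
structure IsSemiConformalSubmersion {m : ℕ} {N : Type*} [TopologicalSpace N]
    [ChartedSpace (E m) N] [IsManifold 𝓘(ℝ, E n) ∞ M] [IsManifold 𝓘(ℝ, E m) ∞ N]
    (g : Metric n M) (h : Metric m N) (φ : M → N) (lam : M → ℝ) : Prop where
  contMDiff : ContMDiff 𝓘(ℝ, E n) 𝓘(ℝ, E m) ∞ φ
  surjective : ∀ x, Function.Surjective (mfderiv 𝓘(ℝ, E n) 𝓘(ℝ, E m) φ x)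
  dilation_pos : ∀ x, 0 < lam x
  conformal : ∀ (x : M) (X Y : TangentSpace 𝓘(ℝ, E n) x),
    (∀ Z : TangentSpace 𝓘(ℝ, E n) x, mfderiv 𝓘(ℝ, E n) 𝓘(ℝ, E m) φ x Z = 0 → g.inner x X Z = 0) →
    (∀ Z : TangentSpace 𝓘(ℝ, E n) x, mfderiv 𝓘(ℝ, E n) 𝓘(ℝ, E m) φ x Z = 0 → g.inner x Y Z = 0) →
    lam x ^ 2 * g.inner x X Y =
      h.inner (φ x) (mfderiv 𝓘(ℝ, E n) 𝓘(ℝ, E m) φ x X) (mfderiv 𝓘(ℝ, E n) 𝓘(ℝ, E m) φ x Y)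

/-- `U` is a smooth unit vertical vector field on the set `W`: `dφ(U) = 0` and `g(U, U) = 1`. -/
structure IsUnitVerticalOn {m : ℕ} {N : Type*} [TopologicalSpace N]
    [ChartedSpace (E m) N] [IsManifold 𝓘(ℝ, E n) ∞ M]
    (g : Metric n M) (φ : M → N) (U : ∀ x : M, TangentSpace 𝓘(ℝ, E n) x) (W : Set M) : Prop where
  contMDiffOn : ContMDiffOn 𝓘(ℝ, E n) 𝓘(ℝ, E n).tangent ∞
    (fun x => (⟨x, U x⟩ : TangentBundle 𝓘(ℝ, E n) M)) W
  vertical : ∀ x ∈ W, mfderiv 𝓘(ℝ, E n) 𝓘(ℝ, E m) φ x (U x) = 0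
  unit : ∀ x ∈ W, g.inner x (U x) (U x) = 1

end Manifolds

end SemiConformal

end

/-! Both sides are bilinear, so it suffices to compare them at a point on one orthonormal frame. The
frame is adapted to `φ`: `e 0` and `e 1` are `λ` times the horizontal lifts of a local orthonormal
frame of `N`, and `e 2 = U`.

Semi-conformality enters through brackets only (`struc_horizontal`, `struc_vertical`). Modulo `U`,
`[U, e i]` is `U(ln λ) e i`, and `[e 0, e 1]` is the bracket from `N` scaled by `λ` plus derivatives
of `ln λ`. By the Koszul formula (`IsFrameOn.conn_eq`) the horizontal shear of the fibres vanishes,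
their expansion is `U(ln λ)`, and a single twist coefficient `conn 0 1 2` carries `I` and the
horizontal part of `Ω`.

Every term is then a polynomial in connection coefficients, derivatives of `ln λ` and their first
derivatives along the frame: curvature by `riem_frame`, the operators by `laplacian_eq` and
`codiff_eq`, and `λ² K` by `dilation_sq_mul_gaussCurvature`. In `λ² K + Δ ln λ + μ(ln λ)` all
horizontal derivatives of `ln λ` cancel. The nine components agree up to the first Bianchi identity,
which is needed because Ricci in this form is not visibly symmetric. A last part transfers the
result from open sets of `ℝ³` and `ℝ²` to charts. -/

noncomputable section

set_option maxSynthPendingDepth 5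

namespace SemiConformal

variable {n : ℕ}

/-! ### Smooth metrics on open sets and their Christoffel symbols -/

/-- The coordinate expression of a field of bilinear forms. -/
abbrev toForm (B : E n → E n →L[ℝ] E n →L[ℝ] ℝ) : E n → E n → E n → ℝ := fun y u v => B y u v

/-- `B` is a smooth Riemannian metric on the open set `O`. -/
structure IsMetricOn (B : E n → E n →L[ℝ] E n →L[ℝ] ℝ) (O : Set (E n)) : Prop where
  isOpen : IsOpen O
  contDiffOn : ContDiffOn ℝ ∞ B O
  symm : ∀ y ∈ O, ∀ u v, B y u v = B y v u
  pos : ∀ y ∈ O, ∀ u, u ≠ 0 → 0 < B y u u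

theorem sum_smul_coordVec (x : E n) : ∑ i, x i • coordVec i = x := by
  ext j
  simp [coordVec, Finset.sum_apply, Pi.single_apply]

theorem clm_ext_coordVec {F : Type*} [AddCommMonoid F] [Module ℝ F] [TopologicalSpace F]
    {α β : E n →L[ℝ] F} (h : ∀ i, α (coordVec i) = β (coordVec i)) : α = β := by
  ext x
  rw [← sum_smul_coordVec x]
  simp [h]

theorem differentiableAt_of_contDiffOn {F : Type*} [NormedAddCommGroup F] [NormedSpace ℝ F]
    {O : Set (E n)} (hO : IsOpen O) {f : E n → F} (hf : ContDiffOn ℝ ∞ f O) {y : E n}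
    (hy : y ∈ O) : DifferentiableAt ℝ f y :=
  (hf.contDiffAt (hO.mem_nhds hy)).differentiableAt (by simp)

theorem contDiffOn_fderiv {F : Type*} [NormedAddCommGroup F] [NormedSpace ℝ F]
    {O : Set (E n)} (hO : IsOpen O) {f : E n → F} (hf : ContDiffOn ℝ ∞ f O) :
    ContDiffOn ℝ ∞ (fderiv ℝ f) O :=
  hf.fderiv_of_isOpen hO (by simp)

theorem fderiv_congr_on {F : Type*} [NormedAddCommGroup F] [NormedSpace ℝ F]
    {O : Set (E n)} (hO : IsOpen O) {f f' : E n → F} (h : ∀ z ∈ O, f z = f' z) {y : E n}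
    (hy : y ∈ O) : fderiv ℝ f y = fderiv ℝ f' y :=
  Filter.EventuallyEq.fderiv_eq (Filter.eventually_of_mem (hO.mem_nhds hy) h)

/-- The derivative of `z ↦ A z (X z) (Y z)`. -/
theorem fderiv_bilin_apply {F : Type*} [NormedAddCommGroup F] [NormedSpace ℝ F]
    {A : E n → E n →L[ℝ] E n →L[ℝ] F} {X Y : E n → E n} {y : E n}
    (hA : DifferentiableAt ℝ A y) (hX : DifferentiableAt ℝ X y) (hY : DifferentiableAt ℝ Y y)
    (u : E n) : fderiv ℝ (fun z => A z (X z) (Y z)) y u =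
      fderiv ℝ A y u (X y) (Y y) + A y (fderiv ℝ X y u) (Y y) + A y (X y) (fderiv ℝ Y y u) := by
  rw [((hA.hasFDerivAt.clm_apply hX.hasFDerivAt).clm_apply hY.hasFDerivAt).fderiv]
  simp
  abel

theorem fderiv_bilin_const {F : Type*} [NormedAddCommGroup F] [NormedSpace ℝ F]
    {A : E n → E n →L[ℝ] E n →L[ℝ] F} {y : E n} (hA : DifferentiableAt ℝ A y) (v w u : E n) :
    fderiv ℝ (fun z => A z v w) y u = fderiv ℝ A y u v w := by
  rw [fderiv_bilin_apply hA (differentiableAt_const v) (differentiableAt_const w)]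
  simp

/-- The `1`-forms `½ (∂ᵤ g(v, ·) + ∂ᵥ g(u, ·) - d(g(u, v)))`. -/
def chrForm (B : E n → E n →L[ℝ] E n →L[ℝ] ℝ) (y : E n) :
    E n →L[ℝ] E n →L[ℝ] E n →L[ℝ] ℝ :=
  (1 / 2 : ℝ) • (fderiv ℝ B y + (fderiv ℝ B y).flip
    - ((ContinuousLinearMap.flipₗᵢ ℝ (E n) (E n) ℝ).toContinuousLinearEquiv.toContinuousLinearMap.comp
      (fderiv ℝ B y).flip))

theorem chrForm_apply (B : E n → E n →L[ℝ] E n →L[ℝ] ℝ) (y u v w : E n) :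
    chrForm B y u v w =
      (1 / 2) * (fderiv ℝ B y u v w + fderiv ℝ B y v u w - fderiv ℝ B y w u v) := by
  simp [chrForm]

/-- The Christoffel symbols as a continuous bilinear map. -/
def chr (B : E n → E n →L[ℝ] E n →L[ℝ] ℝ) (y : E n) : E n →L[ℝ] E n →L[ℝ] E n :=
  (ContinuousLinearMap.compL ℝ (E n) (E n →L[ℝ] ℝ) (E n) (B y).inverse).comp (chrForm B y)

namespace IsMetricOn

variable {B : E n → E n →L[ℝ] E n →L[ℝ] ℝ} {O : Set (E n)} {y : E n}

/-- A kernel vector `v` of the Gram matrix would satisfy `B y v v = 0`, against positivity. -/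
theorem det_gram_ne_zero (hB : IsMetricOn B O) (hy : y ∈ O) : (gram (toForm B) y).det ≠ 0 := by
  intro h
  obtain ⟨v, hv, h0⟩ := Matrix.exists_mulVec_eq_zero_iff.2 h
  have hv' : (WithLp.toLp 2 v : E n) ≠ 0 := by
    intro h; apply hv; simpa using h
  have := hB.pos y hy _ hv'
  rw [← sum_smul_coordVec (WithLp.toLp 2 v : E n)] at this
  simp only [map_sum, map_smul, FunLike.coe_sum, Finset.sum_apply,
    FunLike.coe_smul, Pi.smul_apply, smul_eq_mul] at this
  have h1 : ∀ i, ∑ j, B y (coordVec i) (coordVec j) * v j = 0 := fun i => by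
    have := congrFun h0 i
    simpa [Matrix.mulVec, dotProduct, gram] using this
  refine this.ne' (Finset.sum_eq_zero fun i _ => ?_)
  have h2 := h1 i
  simp only [mul_comm _ (v _), hB.symm y hy (coordVec i)] at h2
  rw [h2, mul_zero]

theorem apply_sharp (hB : IsMetricOn B O) (hy : y ∈ O) (α : E n →L[ℝ] ℝ) :
    B y (sharp (toForm B) y α) = α := by
  refine clm_ext_coordVec fun k => ?_
  have hg : gram (toForm B) y * (gram (toForm B) y)⁻¹ = 1 :=
    Matrix.mul_nonsing_inv _ (hB.det_gram_ne_zero hy).isUnit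
  simp only [sharp, map_sum, map_smul, FunLike.coe_sum, Finset.sum_apply,
    FunLike.coe_smul, Pi.smul_apply, smul_eq_mul]
  rw [Finset.sum_comm]
  calc _ = ∑ j, (gram (toForm B) y * (gram (toForm B) y)⁻¹) k j * α (coordVec j) := by
        refine Finset.sum_congr rfl fun j _ => ?_
        rw [Matrix.mul_apply, Finset.sum_mul]
        refine Finset.sum_congr rfl fun i _ => ?_
        simp only [gram, Matrix.of_apply, hB.symm y hy (coordVec i)]
        ring
    _ = _ := by simp [hg, Matrix.one_apply]

theorem injective (hB : IsMetricOn B O) (hy : y ∈ O) : Function.Injective (B y) := by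
  rw [injective_iff_map_eq_zero]
  intro u hu
  by_contra h
  have := hB.pos y hy u h
  simp [hu] at this

theorem ext (hB : IsMetricOn B O) (hy : y ∈ O) {u v : E n} (h : ∀ w, B y u w = B y v w) : u = v :=
  hB.injective hy (ContinuousLinearMap.ext h)

theorem exists_equiv (hB : IsMetricOn B O) (hy : y ∈ O) :
    ∃ e : E n ≃L[ℝ] (E n →L[ℝ] ℝ), (e : E n →L[ℝ] E n →L[ℝ] ℝ) = B y := by
  refine ⟨ContinuousLinearEquiv.ofBijective (B y) (LinearMap.ker_eq_bot.2 (hB.injective hy))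
    (LinearMap.range_eq_top.2 fun α => ⟨_, hB.apply_sharp hy α⟩), ?_⟩
  ext u v
  rfl

/-- Replaces the matrix inverse by operator inversion, whose smoothness gives that of `sharp` and of
`chr` without looking at entries. -/
theorem sharp_eq_inverse (hB : IsMetricOn B O) (hy : y ∈ O) (α : E n →L[ℝ] ℝ) :
    sharp (toForm B) y α = (B y).inverse α := by
  obtain ⟨e, he⟩ := hB.exists_equiv hy
  rw [← he, ContinuousLinearMap.inverse_equiv]
  apply e.injective
  have := hB.apply_sharp hy α
  rw [← he] at this
  simpa using this

theorem contDiffOn_inverse (hB : IsMetricOn B O) :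
    ContDiffOn ℝ ∞ (fun z => (B z).inverse) O := by
  intro y hy
  obtain ⟨e, he⟩ := hB.exists_equiv hy
  have h := contDiffAt_map_inverse (n := ∞) e
  rw [he] at h
  exact h.comp_contDiffWithinAt y (hB.contDiffOn y hy)

theorem contDiffOn_sharp (hB : IsMetricOn B O) {α : E n → E n →L[ℝ] ℝ}
    (hα : ContDiffOn ℝ ∞ α O) : ContDiffOn ℝ ∞ (fun z => sharp (toForm B) z (α z)) O :=
  (hB.contDiffOn_inverse.clm_apply hα).congr fun z hz => hB.sharp_eq_inverse hz (α z)

theorem differentiableAt (hB : IsMetricOn B O) (hy : y ∈ O) : DifferentiableAt ℝ B y :=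
  differentiableAt_of_contDiffOn hB.isOpen hB.contDiffOn hy

theorem christoffel_eq (hB : IsMetricOn B O) (hy : y ∈ O) (u v : E n) :
    christoffel (toForm B) y u v = chr B y u v := by
  have : (fun w => (1 / 2) *
    (fderiv ℝ (fun z => toForm B z v w) y u + fderiv ℝ (fun z => toForm B z u w) y v
      - fderiv ℝ (fun z => toForm B z u v) y w)) = chrForm B y u v := by
    funext w
    simp only [toForm, fderiv_bilin_const (hB.differentiableAt hy), chrForm_apply]
  rw [christoffel, this, hB.sharp_eq_inverse hy]
  simp [chr]

theorem contDiffOn_chr (hB : IsMetricOn B O) : ContDiffOn ℝ ∞ (chr B) O := by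
  have hT := contDiffOn_fderiv hB.isOpen hB.contDiffOn
  have hflip : ContDiffOn ℝ ∞ (fun z => (fderiv ℝ B z).flip) O :=
    (ContinuousLinearMap.flipₗᵢ ℝ (E n) (E n) (E n →L[ℝ] ℝ)).contDiff.comp_contDiffOn hT
  have hC : ContDiffOn ℝ ∞ (chrForm B) O :=
    ((hT.add hflip).sub (contDiffOn_const.clm_comp hflip)).const_smul (1 / 2 : ℝ)
  exact ((ContinuousLinearMap.compL ℝ (E n) (E n →L[ℝ] ℝ) (E n)).contDiff.comp_contDiffOn
    hB.contDiffOn_inverse).clm_comp hC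

theorem apply_chr (hB : IsMetricOn B O) (hy : y ∈ O) (u v w : E n) :
    B y (chr B y u v) w =
      (1 / 2) * (fderiv ℝ B y u v w + fderiv ℝ B y v u w - fderiv ℝ B y w u v) := by
  rw [← chrForm_apply]
  have := hB.apply_sharp hy (chrForm B y u v)
  rw [hB.sharp_eq_inverse hy] at this
  exact congrArg (fun α => α w) this

theorem fderiv_symm (hB : IsMetricOn B O) (hy : y ∈ O) (u v w : E n) :
    fderiv ℝ B y u v w = fderiv ℝ B y u w v := by
  rw [← fderiv_bilin_const (hB.differentiableAt hy), ← fderiv_bilin_const (hB.differentiableAt hy),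
    fderiv_congr_on hB.isOpen (fun z hz => hB.symm z hz v w) hy]

theorem chr_symm (hB : IsMetricOn B O) (hy : y ∈ O) (u v : E n) :
    chr B y u v = chr B y v u := by
  refine hB.ext hy fun w => ?_
  rw [hB.apply_chr hy, hB.apply_chr hy, hB.fderiv_symm hy w u v]
  ring

/-- Metric compatibility for constant fields: in the sum of the two Koszul expressions all but one
derivative cancels. -/
theorem fderiv_eq_chr (hB : IsMetricOn B O) (hy : y ∈ O) (u v w : E n) :
    fderiv ℝ B y u v w = B y (chr B y u v) w + B y v (chr B y u w) := by
  rw [hB.symm y hy v, hB.apply_chr hy, hB.apply_chr hy, hB.fderiv_symm hy u w v,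
    hB.fderiv_symm hy v u w, hB.fderiv_symm hy w u v]
  ring

end IsMetricOn

/-! ### Covariant derivative and curvature for smooth vector fields -/

/-- The covariant derivative `∇_u X` at `y`, in terms of `chr`. -/
def nabla (B : E n → E n →L[ℝ] E n →L[ℝ] ℝ) (X : E n → E n) (y : E n) : E n →L[ℝ] E n :=
  fderiv ℝ X y + (chr B y).flip (X y)

theorem nabla_apply (B : E n → E n →L[ℝ] E n →L[ℝ] ℝ) (X : E n → E n) (y u : E n) :
    nabla B X y u = fderiv ℝ X y u + chr B y u (X y) := rfl

/-- The curvature `R(u, v)w` at `y` in terms of the Christoffel symbols. -/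
def riem (B : E n → E n →L[ℝ] E n →L[ℝ] ℝ) (y u v w : E n) : E n :=
  fderiv ℝ (chr B) y u v w + chr B y u (chr B y v w)
    - (fderiv ℝ (chr B) y v u w + chr B y v (chr B y u w))

theorem riem_swap (B : E n → E n →L[ℝ] E n →L[ℝ] ℝ) (y u v w : E n) :
    riem B y v u w = - riem B y u v w := by
  simp only [riem]
  abel

namespace IsMetricOn

variable {B : E n → E n →L[ℝ] E n →L[ℝ] ℝ} {O : Set (E n)} {y : E n}

theorem differentiableAt_chr (hB : IsMetricOn B O) (hy : y ∈ O) : DifferentiableAt ℝ (chr B) y :=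
  differentiableAt_of_contDiffOn hB.isOpen hB.contDiffOn_chr hy

theorem cov_eq (hB : IsMetricOn B O) (hy : y ∈ O) (X : E n → E n) (u : E n) :
    cov (toForm B) X y u = nabla B X y u := by
  rw [cov, hB.christoffel_eq hy, nabla_apply]

theorem contDiffOn_nabla (hB : IsMetricOn B O) {X Y : E n → E n} (hX : ContDiffOn ℝ ∞ X O)
    (hY : ContDiffOn ℝ ∞ Y O) : ContDiffOn ℝ ∞ (fun z => nabla B Y z (X z)) O :=
  ((contDiffOn_fderiv hB.isOpen hY).clm_apply hX).add
    ((hB.contDiffOn_chr.clm_apply hX).clm_apply hY)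

theorem fderiv_apply (hB : IsMetricOn B O) (hy : y ∈ O) {X Y : E n → E n}
    (hX : ContDiffOn ℝ ∞ X O) (hY : ContDiffOn ℝ ∞ Y O) (u : E n) :
    fderiv ℝ (fun z => B z (X z) (Y z)) y u =
      B y (nabla B X y u) (Y y) + B y (X y) (nabla B Y y u) := by
  rw [fderiv_bilin_apply (hB.differentiableAt hy) (differentiableAt_of_contDiffOn hB.isOpen hX hy)
    (differentiableAt_of_contDiffOn hB.isOpen hY hy), hB.fderiv_eq_chr hy, nabla_apply,
    nabla_apply]
  simp only [map_add, add_apply]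
  ring

theorem contDiffOn_apply (hB : IsMetricOn B O) {X Y : E n → E n} (hX : ContDiffOn ℝ ∞ X O)
    (hY : ContDiffOn ℝ ∞ Y O) : ContDiffOn ℝ ∞ (fun z => B z (X z) (Y z)) O :=
  (hB.contDiffOn.clm_apply hX).clm_apply hY

theorem nabla_sub_nabla (hB : IsMetricOn B O) (hy : y ∈ O) (X Y : E n → E n) :
    nabla B Y y (X y) - nabla B X y (Y y) = VectorField.lieBracket ℝ X Y y := by
  rw [nabla_apply, nabla_apply, hB.chr_symm hy, VectorField.lieBracket]
  abel

theorem curvature_eq (hB : IsMetricOn B O) (hy : y ∈ O) (u v w : E n) :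
    curvature (toForm B) y u v w = riem B y u v w := by
  have key : ∀ a b : E n, cov (toForm B) (fun z => christoffel (toForm B) z b w) y a =
      fderiv ℝ (chr B) y a b w + chr B y a (chr B y b w) := fun a b => by
    rw [hB.cov_eq hy, nabla_apply, fderiv_congr_on hB.isOpen
      (fun z hz => hB.christoffel_eq hz b w) hy, fderiv_bilin_const (hB.differentiableAt_chr hy),
      hB.christoffel_eq hy]
  rw [curvature, key, key, riem]

/-- `chr` is symmetric on an open set, hence so is its derivative, and the cyclic sum cancels in
pairs. -/
theorem riem_bianchi (hB : IsMetricOn B O) (hy : y ∈ O) (u v w : E n) :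
    riem B y u v w + riem B y v w u + riem B y w u v = 0 := by
  have h : ∀ a b c : E n, fderiv ℝ (chr B) y a b c = fderiv ℝ (chr B) y a c b := fun a b c => by
    rw [← fderiv_bilin_const (hB.differentiableAt_chr hy),
      ← fderiv_bilin_const (hB.differentiableAt_chr hy),
      fderiv_congr_on hB.isOpen (fun z hz => hB.chr_symm hz b c) hy]
  simp only [riem]
  rw [h u w v, h v w u, h w v u, hB.chr_symm hy w v, hB.chr_symm hy u w, hB.chr_symm hy v u]
  abel

/-- Passes from constant extensions to arbitrary fields: the second derivatives of `Z` cancel by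
symmetry, and the derivatives of `X` and `Y` assemble into the bracket term. -/
theorem riem_apply (hB : IsMetricOn B O) (hy : y ∈ O) {X Y Z : E n → E n}
    (hX : ContDiffOn ℝ ∞ X O) (hY : ContDiffOn ℝ ∞ Y O) (hZ : ContDiffOn ℝ ∞ Z O) :
    riem B y (X y) (Y y) (Z y) =
      nabla B (fun z => nabla B Z z (Y z)) y (X y) - nabla B (fun z => nabla B Z z (X z)) y (Y y)
        - nabla B Z y (VectorField.lieBracket ℝ X Y y) := by
  have hd := fun {W : E n → E n} (hW : ContDiffOn ℝ ∞ W O) =>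
    differentiableAt_of_contDiffOn hB.isOpen hW hy
  have hZ2 := differentiableAt_of_contDiffOn hB.isOpen (contDiffOn_fderiv hB.isOpen hZ) hy
  have hsymm : IsSymmSndFDerivAt ℝ Z y :=
    (hZ.contDiffAt (hB.isOpen.mem_nhds hy)).isSymmSndFDerivAt (by
      rw [minSmoothness_of_isRCLikeNormedField]; exact WithTop.coe_le_coe.2 le_top)
  have key : ∀ {W : E n → E n} (hW : ContDiffOn ℝ ∞ W O) (u : E n),
      fderiv ℝ (fun z => nabla B Z z (W z)) y u =
        fderiv ℝ (fderiv ℝ Z) y u (W y) + fderiv ℝ Z y (fderiv ℝ W y u)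
        + (fderiv ℝ (chr B) y u (W y) (Z y) + chr B y (fderiv ℝ W y u) (Z y)
          + chr B y (W y) (fderiv ℝ Z y u)) := fun {W} hW u => by
    simp only [nabla_apply]
    rw [fderiv_fun_add (hZ2.clm_apply (hd hW))
      (((hB.differentiableAt_chr hy).clm_apply (hd hW)).clm_apply (hd hZ)), add_apply,
      fderiv_bilin_apply (hB.differentiableAt_chr hy) (hd hW) (hd hZ),
      fderiv_clm_apply hZ2 (hd hW)]
    simp
    abel
  rw [nabla_apply _ (fun z => nabla B Z z (Y z)), nabla_apply _ (fun z => nabla B Z z (X z)),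
    key hX, key hY, nabla_apply, nabla_apply, nabla_apply, VectorField.lieBracket,
    hsymm (X y) (Y y), riem]
  simp only [map_add, map_sub, sub_apply, hB.chr_symm hy (Y y) (fderiv ℝ Z y (X y)),
    hB.chr_symm hy (X y) (fderiv ℝ Z y (Y y))]
  rw [hB.chr_symm hy (fderiv ℝ Z y (X y)), hB.chr_symm hy (fderiv ℝ Z y (Y y))]
  abel

theorem lieDerivMetric_eq (hB : IsMetricOn B O) (hy : y ∈ O) (X : E n → E n) (u v : E n) :
    lieDerivMetric (toForm B) X y u v = B y (nabla B X y u) v + B y u (nabla B X y v) := by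
  simp only [lieDerivMetric, toForm]
  rw [fderiv_bilin_const (hB.differentiableAt hy), hB.fderiv_eq_chr hy, nabla_apply, nabla_apply,
    hB.chr_symm hy u, hB.chr_symm hy v]
  simp only [map_add, add_apply]
  ring

theorem extDeriv_flat_eq (hB : IsMetricOn B O) (hy : y ∈ O) {X : E n → E n}
    (hX : ContDiffOn ℝ ∞ X O) (u v : E n) :
    extDeriv (flat (toForm B) X) y u v = B y (nabla B X y u) v - B y (nabla B X y v) u := by
  have h : ∀ a b, fderiv ℝ (fun z => B z (X z) b) y a =
      B y (nabla B X y a) b + B y (X y) (chr B y a b) := fun a b => by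
    rw [hB.fderiv_apply hy hX contDiffOn_const]
    simp [nabla_apply]
  simp only [extDeriv, flat, toForm]
  rw [h, h, hB.chr_symm hy u v]
  ring

end IsMetricOn

/-! ### Traces in an orthonormal basis -/

namespace IsMetricOn

variable {B : E n → E n →L[ℝ] E n →L[ℝ] ℝ} {O : Set (E n)} {y : E n} {v : Fin n → E n}

/-- Orthonormality says that the product in the other order is the identity; for square matrices one
order implies the other. -/
theorem frame_mul (hv : ∀ a b, B y (v a) (v b) = if a = b then 1 else 0) :
    (Matrix.of fun i a => v a i) * (Matrix.of fun a i => B y (coordVec i) (v a)) = 1 := by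
  rw [mul_eq_one_comm]
  ext a b
  have : B y (v b) (v a) = ∑ i, v b i * B y (coordVec i) (v a) := by
    conv_lhs => rw [← sum_smul_coordVec (v b)]
    simp
  rw [Matrix.mul_apply, Matrix.one_apply, show (if a = b then (1 : ℝ) else 0) = B y (v b) (v a) by
    rw [hv]; simp only [eq_comm], this]
  simp [mul_comm]

theorem sum_apply_smul (hv : ∀ a b, B y (v a) (v b) = if a = b then 1 else 0) (x : E n) :
    ∑ a, B y x (v a) • v a = x := by
  have : ∑ a, ((B y).flip (v a)).smulRight (v a) = ContinuousLinearMap.id ℝ (E n) := by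
    refine clm_ext_coordVec fun j => ?_
    ext i
    have h := congrFun (congrFun (frame_mul hv) i) j
    rw [Matrix.mul_apply, Matrix.one_apply] at h
    simp only [Matrix.of_apply] at h
    simp [coordVec, ← h, mul_comm]
  simpa using congrArg (fun T => T x) this

theorem apply_eq_sum (hv : ∀ a b, B y (v a) (v b) = if a = b then 1 else 0) (x x' : E n) :
    B y x x' = ∑ a, B y x (v a) * B y x' (v a) := by
  conv_lhs => rw [← sum_apply_smul hv x']
  simp [mul_comm]

/-- If `A` is the matrix of components of the basis, then the inverse Gram matrix is `A Aᵀ`. -/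
theorem metricTrace_eq (hB : IsMetricOn B O) (hy : y ∈ O)
    (hv : ∀ a b, B y (v a) (v b) = if a = b then 1 else 0) {f : E n → E n → ℝ}
    (h₁ : ∀ w, IsLinearMap ℝ fun u => f u w) (h₂ : ∀ u, IsLinearMap ℝ (f u)) :
    metricTrace (toForm B) y f = ∑ a, f (v a) (v a) := by
  have hinv : (gram (toForm B) y)⁻¹ =
      (Matrix.of fun i a => v a i) * (Matrix.of fun i a => v a i).transpose := by
    refine Matrix.inv_eq_left_inv ?_
    rw [Matrix.mul_assoc, ← frame_mul hv]
    congr 1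
    ext a j
    have : B y (v a) (coordVec j) = ∑ i, v a i * B y (coordVec i) (coordVec j) := by
      conv_lhs => rw [← sum_smul_coordVec (v a)]
      simp
    rw [Matrix.of_apply, hB.symm y hy, this, Matrix.mul_apply]
    rfl
  have hf : ∀ u w, f u w = ∑ i, ∑ j, u i * w j * f (coordVec i) (coordVec j) := fun u w => by
    have h1 : f u w = ∑ i, u i * f (coordVec i) w := by
      conv_lhs => rw [← sum_smul_coordVec u]
      exact (map_sum ((h₁ w).mk') (fun i => u i • coordVec i) Finset.univ).trans
        (Finset.sum_congr rfl fun i _ => (h₁ w).map_smul _ _)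
    have h2 : ∀ u, f u w = ∑ j, w j * f u (coordVec j) := fun u => by
      conv_lhs => rw [← sum_smul_coordVec w]
      exact (map_sum ((h₂ u).mk') (fun i => w i • coordVec i) Finset.univ).trans
        (Finset.sum_congr rfl fun i _ => (h₂ u).map_smul _ _)
    rw [h1]
    refine Finset.sum_congr rfl fun i _ => ?_
    rw [h2, Finset.mul_sum]
    exact Finset.sum_congr rfl fun j _ => by ring
  simp only [metricTrace, hinv, Matrix.mul_apply, Matrix.transpose_apply, Matrix.of_apply,
    Finset.sum_mul]
  simp only [hf (v _) (v _)]
  conv_rhs => rw [Finset.sum_comm]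
  refine Finset.sum_congr rfl fun i _ => ?_
  rw [Finset.sum_comm]

theorem ricci_eq (hB : IsMetricOn B O) (hy : y ∈ O)
    (hv : ∀ a b, B y (v a) (v b) = if a = b then 1 else 0) (w x : E n) :
    ricci (toForm B) y w x = ∑ a, B y (riem B y (v a) w x) (v a) := by
  have h : ∀ u, riem B y u w x = ∑ a, B y u (v a) • riem B y (v a) w x := fun u => by
    conv_lhs => rw [← sum_apply_smul hv u]
    simp [riem, Finset.sum_add_distrib, smul_sub, smul_add]
  have h' : ∀ a, B y (riem B y (v a) w x) (v a) =
      ∑ i, riem B y (v a) w x i * B y (coordVec i) (v a) := fun a => by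
    conv_lhs => rw [← sum_smul_coordVec (riem B y (v a) w x)]
    simp
  simp only [ricci, hB.curvature_eq hy, h']
  rw [Finset.sum_comm]
  refine Finset.sum_congr rfl fun i _ => ?_
  rw [h (coordVec i)]
  simp [mul_comm]

end IsMetricOn

/-! ### Orthonormal frames: connection coefficients, structure functions, curvature and operators -/

/-- `e` is a smooth orthonormal frame on `O`. -/
structure IsFrameOn (B : E n → E n →L[ℝ] E n →L[ℝ] ℝ) (e : Fin n → E n → E n) (O : Set (E n)) :
    Prop where
  contDiffOn : ∀ a, ContDiffOn ℝ ∞ (e a) O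
  orthonormal : ∀ z ∈ O, ∀ a b, B z (e a z) (e b z) = if a = b then 1 else 0

/-- The connection coefficients `g(∇_{e_a} e_b, e_c)` of a frame. -/
def conn (B : E n → E n →L[ℝ] E n →L[ℝ] ℝ) (e : Fin n → E n → E n) (a b c : Fin n) (z : E n) : ℝ :=
  B z (nabla B (e b) z (e a z)) (e c z)

/-- The structure functions `g([e_a, e_b], e_c)` of a frame. -/
def struc (B : E n → E n →L[ℝ] E n →L[ℝ] ℝ) (e : Fin n → E n → E n) (a b c : Fin n) (z : E n) :
    ℝ :=
  B z (VectorField.lieBracket ℝ (e a) (e b) z) (e c z)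

theorem struc_swap (B : E n → E n →L[ℝ] E n →L[ℝ] ℝ) (e : Fin n → E n → E n) (a b c : Fin n)
    (z : E n) : struc B e b a c z = - struc B e a b c z := by
  rw [struc, VectorField.lieBracket_swap]
  simp [struc]

namespace IsFrameOn

variable {B : E n → E n →L[ℝ] E n →L[ℝ] ℝ} {O : Set (E n)} {y : E n} {e : Fin n → E n → E n}

theorem contDiffOn_conn (he : IsFrameOn B e O) (hB : IsMetricOn B O) (a b c : Fin n) :
    ContDiffOn ℝ ∞ (conn B e a b c) O :=
  hB.contDiffOn_apply (hB.contDiffOn_nabla (he.contDiffOn a) (he.contDiffOn b)) (he.contDiffOn c)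

theorem conn_skew (he : IsFrameOn B e O) (hB : IsMetricOn B O) (hy : y ∈ O) (a b c : Fin n) :
    conn B e a c b y = - conn B e a b c y := by
  have h := hB.fderiv_apply hy (he.contDiffOn b) (he.contDiffOn c) (e a y)
  rw [fderiv_congr_on hB.isOpen (fun z hz => he.orthonormal z hz b c) hy, hB.symm y hy (e b y)] at h
  simp only [fderiv_fun_const, Pi.zero_apply, zero_apply] at h
  simp only [conn]
  linarith

theorem conn_sub_conn (hB : IsMetricOn B O) (hy : y ∈ O) (e : Fin n → E n → E n) (a b c : Fin n) :
    conn B e a b c y - conn B e b a c y = struc B e a b c y := by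
  rw [conn, conn, struc, ← hB.nabla_sub_nabla hy]
  simp

/-- Koszul formula; the derivative terms are absent because the products `B (e a) (e b)` are
constant. -/
theorem conn_eq (he : IsFrameOn B e O) (hB : IsMetricOn B O) (hy : y ∈ O) (a b c : Fin n) :
    conn B e a b c y = (1 / 2) * (struc B e a b c y - struc B e b c a y + struc B e c a b y) := by
  rw [← conn_sub_conn hB hy, ← conn_sub_conn hB hy, ← conn_sub_conn hB hy,
    he.conn_skew hB hy a b c, he.conn_skew hB hy b a c, he.conn_skew hB hy c a b]
  ring

/-- The derivative of a component of a vector field along a frame field. -/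
theorem apply_nabla (he : IsFrameOn B e O) (hB : IsMetricOn B O) (hy : y ∈ O) {X : E n → E n}
    (hX : ContDiffOn ℝ ∞ X O) (a b : Fin n) :
    B y (nabla B X y (e a y)) (e b y) =
      fderiv ℝ (fun z => B z (X z) (e b z)) y (e a y)
        - ∑ f, B y (X y) (e f y) * conn B e a b f y := by
  rw [hB.fderiv_apply hy hX (he.contDiffOn b),
    IsMetricOn.apply_eq_sum (he.orthonormal y hy) (X y)]
  simp [conn]

theorem riem_frame (he : IsFrameOn B e O) (hB : IsMetricOn B O) (hy : y ∈ O) (a b c d : Fin n) :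
    B y (riem B y (e a y) (e b y) (e c y)) (e d y) =
      fderiv ℝ (conn B e b c d) y (e a y) - fderiv ℝ (conn B e a c d) y (e b y)
        - ∑ f, (conn B e b c f y * conn B e a d f y - conn B e a c f y * conn B e b d f y
          + struc B e a b f y * conn B e f c d y) := by
  have hlb : nabla B (e c) y (VectorField.lieBracket ℝ (e a) (e b) y) =
      ∑ f, struc B e a b f y • nabla B (e c) y (e f y) := by
    conv_lhs => rw [← IsMetricOn.sum_apply_smul (he.orthonormal y hy)
      (VectorField.lieBracket ℝ (e a) (e b) y)]
    simp [struc]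
  rw [hB.riem_apply hy (he.contDiffOn a) (he.contDiffOn b) (he.contDiffOn c), hlb]
  simp only [map_sub, sub_apply, map_sum, FunLike.coe_sum, Finset.sum_apply, map_smul,
    FunLike.coe_smul, Pi.smul_apply, smul_eq_mul]
  rw [he.apply_nabla hB hy (hB.contDiffOn_nabla (he.contDiffOn b) (he.contDiffOn c)),
    he.apply_nabla hB hy (hB.contDiffOn_nabla (he.contDiffOn a) (he.contDiffOn c))]
  simp only [Finset.sum_add_distrib, Finset.sum_sub_distrib]
  simp only [← conn.eq_1]
  rw [show (fun z => conn B e b c d z) = conn B e b c d from rfl,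
    show (fun z => conn B e a c d z) = conn B e a c d from rfl]
  ring

/-- The Hessian is tensorial, so constant extensions may be replaced by frame fields: `∇df(e, e) =
e(e(f)) - (∇_e e)(f)`. -/
theorem laplacian_eq (he : IsFrameOn B e O) (hB : IsMetricOn B O) (hy : y ∈ O) {f : E n → ℝ}
    (hf : ContDiffOn ℝ ∞ f O) :
    laplacian (toForm B) f y =
      ∑ a, (fderiv ℝ (fun z => fderiv ℝ f z (e a z)) y (e a y)
        - ∑ b, conn B e a a b y * fderiv ℝ f y (e b y)) := by
  have hd := differentiableAt_of_contDiffOn hB.isOpen (contDiffOn_fderiv hB.isOpen hf) hy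
  have h1 : (fun u v => fderiv ℝ (fun z => fderiv ℝ f z v) y u
      - fderiv ℝ f y (christoffel (toForm B) y u v)) =
      fun u v => fderiv ℝ (fderiv ℝ f) y u v - fderiv ℝ f y (chr B y u v) := by
    funext u v
    rw [hB.christoffel_eq hy, fderiv_clm_apply hd (differentiableAt_const v)]
    simp
  rw [laplacian, h1, hB.metricTrace_eq hy (he.orthonormal y hy)
    (fun w => ⟨fun a b => by simp; ring, fun a b => by simp; ring⟩)
    (fun w => ⟨fun a b => by simp; ring, fun a b => by simp; ring⟩)]
  refine Finset.sum_congr rfl fun a _ => ?_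
  have h2 : ∑ b, conn B e a a b y * fderiv ℝ f y (e b y) =
      fderiv ℝ f y (nabla B (e a) y (e a y)) := by
    conv_rhs => rw [← IsMetricOn.sum_apply_smul (he.orthonormal y hy) (nabla B (e a) y (e a y))]
    simp [conn]
  rw [h2, fderiv_clm_apply hd (differentiableAt_of_contDiffOn hB.isOpen (he.contDiffOn a) hy),
    nabla_apply]
  simp

theorem codiff_eq (he : IsFrameOn B e O) (hB : IsMetricOn B O) (hy : y ∈ O)
    {β : E n → E n →L[ℝ] E n →L[ℝ] ℝ} (hβ : ContDiffOn ℝ ∞ β O) (c : Fin n) :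
    codiff (toForm B) (toForm β) y (e c y) =
      - ∑ a, (fderiv ℝ (fun z => β z (e a z) (e c z)) y (e a y)
        - ∑ f, (conn B e a a f y * β y (e f y) (e c y)
          + conn B e a c f y * β y (e a y) (e f y))) := by
  have hd := differentiableAt_of_contDiffOn hB.isOpen hβ hy
  have h1 : (fun u v => covTwoForm (toForm B) (toForm β) y u v (e c y)) =
      fun u v => fderiv ℝ β y u v (e c y) - β y (chr B y u v) (e c y)
        - β y v (chr B y u (e c y)) := by
    funext u v
    simp only [covTwoForm, hB.christoffel_eq hy, toForm, fderiv_bilin_const hd]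
  rw [codiff, h1, hB.metricTrace_eq hy (he.orthonormal y hy)
    (fun w => ⟨fun a b => by simp; ring, fun a b => by simp; ring⟩)
    (fun w => ⟨fun a b => by simp; ring, fun a b => by simp; ring⟩)]
  refine congrArg _ (Finset.sum_congr rfl fun a _ => ?_)
  have h2 : ∀ b x, ∑ f, conn B e a b f y * β y (e f y) x =
      β y (nabla B (e b) y (e a y)) x := fun b x => by
    conv_rhs => rw [← IsMetricOn.sum_apply_smul (he.orthonormal y hy) (nabla B (e b) y (e a y))]
    simp [conn]
  have h3 : ∀ b x, ∑ f, conn B e a b f y * β y x (e f y) =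
      β y x (nabla B (e b) y (e a y)) := fun b x => by
    conv_rhs => rw [← IsMetricOn.sum_apply_smul (he.orthonormal y hy) (nabla B (e b) y (e a y))]
    simp [conn]
  rw [Finset.sum_add_distrib, h2, h3,
    fderiv_bilin_apply hd (differentiableAt_of_contDiffOn hB.isOpen (he.contDiffOn a) hy)
    (differentiableAt_of_contDiffOn hB.isOpen (he.contDiffOn c) hy), nabla_apply, nabla_apply]
  simp only [map_add, add_apply]
  ring

end IsFrameOn

/-! ### Multilinearity, the 2-form `dX^♭`, and local frames on surfaces -/

section Linearity

variable (B : E n → E n →L[ℝ] E n →L[ℝ] ℝ) (y : E n)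

theorem isLinearMap_riem_left (v w : E n) : IsLinearMap ℝ fun u => riem B y u v w :=
  ⟨fun a b => by simp only [riem, map_add, add_apply]; abel,
    fun c a => by simp only [riem, map_smul, smul_apply]; module⟩

theorem isLinearMap_riem_middle (u w : E n) : IsLinearMap ℝ fun v => riem B y u v w :=
  ⟨fun a b => by simp only [riem, map_add, add_apply]; abel,
    fun c a => by simp only [riem, map_smul, smul_apply]; module⟩

theorem isLinearMap_riem_right (u v : E n) : IsLinearMap ℝ fun w => riem B y u v w :=
  ⟨fun a b => by simp only [riem, map_add]; abel,
    fun c a => by simp only [riem, map_smul]; module⟩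

end Linearity

/-- The `2`-form `dX^♭`, in terms of the covariant derivative of `X`. -/
def dFlat (B : E n → E n →L[ℝ] E n →L[ℝ] ℝ) (X : E n → E n) (y : E n) :
    E n →L[ℝ] E n →L[ℝ] ℝ :=
  (B y).comp (nabla B X y) - ((B y).comp (nabla B X y)).flip

theorem dFlat_apply (B : E n → E n →L[ℝ] E n →L[ℝ] ℝ) (X : E n → E n) (y u v : E n) :
    dFlat B X y u v = B y (nabla B X y u) v - B y (nabla B X y v) u := by
  simp [dFlat]

namespace IsMetricOn

variable {B : E n → E n →L[ℝ] E n →L[ℝ] ℝ} {O : Set (E n)} {y : E n}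

theorem contDiffOn_dFlat (hB : IsMetricOn B O) {X : E n → E n} (hX : ContDiffOn ℝ ∞ X O) :
    ContDiffOn ℝ ∞ (dFlat B X) O := by
  have h1 : ContDiffOn ℝ ∞ (fun z => (chr B z).flip) O :=
    (ContinuousLinearMap.flipₗᵢ ℝ (E n) (E n) (E n)).contDiff.comp_contDiffOn hB.contDiffOn_chr
  have h2 : ContDiffOn ℝ ∞ (nabla B X) O :=
    (contDiffOn_fderiv hB.isOpen hX).add (h1.clm_apply hX)
  have h3 := hB.contDiffOn.clm_comp h2
  exact h3.sub ((ContinuousLinearMap.flipₗᵢ ℝ (E n) (E n) ℝ).contDiff.comp_contDiffOn h3)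

/-- The two forms agree only on `O`; that is enough, since `codiff` sees only the germ at `y`. -/
theorem codiff_extDeriv_flat (hB : IsMetricOn B O) (hy : y ∈ O) {X : E n → E n}
    (hX : ContDiffOn ℝ ∞ X O) :
    codiff (toForm B) (extDeriv (flat (toForm B) X)) y =
      codiff (toForm B) (toForm (dFlat B X)) y := by
  have h : ∀ z ∈ O, ∀ u v, extDeriv (flat (toForm B) X) z u v = dFlat B X z u v :=
    fun z hz u v => by rw [hB.extDeriv_flat_eq hz hX, dFlat_apply]
  funext w
  simp only [codiff, covTwoForm, toForm]
  simp only [h y hy]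
  congr 2
  funext u v
  rw [fderiv_congr_on hB.isOpen (fun z hz => h z hz v w) hy]

theorem isLinearMap_codiff (hB : IsMetricOn B O) (hy : y ∈ O)
    {β : E n → E n →L[ℝ] E n →L[ℝ] ℝ} (hβ : DifferentiableAt ℝ β y) :
    IsLinearMap ℝ (codiff (toForm B) (toForm β) y) := by
  constructor
  · intro u v
    simp only [codiff, metricTrace, covTwoForm, toForm, hB.christoffel_eq hy,
      fderiv_bilin_const hβ]
    simp only [map_add]
    rw [← neg_add, ← Finset.sum_add_distrib]
    refine congrArg _ (Finset.sum_congr rfl fun i _ => ?_)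
    rw [← Finset.sum_add_distrib]
    exact Finset.sum_congr rfl fun j _ => by ring
  · intro c u
    simp only [codiff, metricTrace, covTwoForm, toForm, hB.christoffel_eq hy,
      fderiv_bilin_const hβ]
    simp only [map_smul, smul_eq_mul]
    rw [mul_neg, Finset.mul_sum]
    refine congrArg _ (Finset.sum_congr rfl fun i _ => ?_)
    rw [Finset.mul_sum]
    exact Finset.sum_congr rfl fun j _ => by ring

/-- Reduces the Ricci formula to its components on the frame. -/
theorem ext_bilin {v : Fin n → E n} (hv : ∀ a b, B y (v a) (v b) = if a = b then 1 else 0)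
    {f f' : E n → E n → ℝ} (h₁ : ∀ w, IsLinearMap ℝ fun u => f u w)
    (h₂ : ∀ u, IsLinearMap ℝ (f u)) (h₁' : ∀ w, IsLinearMap ℝ fun u => f' u w)
    (h₂' : ∀ u, IsLinearMap ℝ (f' u)) (h : ∀ a b, f (v a) (v b) = f' (v a) (v b)) :
    ∀ u w, f u w = f' u w := by
  intro u w
  have key : ∀ {f f' : E n → ℝ}, IsLinearMap ℝ f → IsLinearMap ℝ f' →
      (∀ a, f (v a) = f' (v a)) → ∀ u, f u = f' u := fun {f f'} hf hf' h u => by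
    rw [← sum_apply_smul hv u]
    refine (map_sum hf.mk' _ _).trans (Eq.trans ?_ (map_sum hf'.mk' _ _).symm)
    refine Finset.sum_congr rfl fun a _ => ?_
    change f _ = f' _
    rw [hf.map_smul, hf'.map_smul, h]
  exact key (h₁ w) (h₁' w) (fun a => key (h₂ _) (h₂' _) (h a) w) u

/-- The vector field `X / |X|`. -/
theorem exists_normalize (hB : IsMetricOn B O) {X : E n → E n} (hX : ContDiffOn ℝ ∞ X O)
    (h0 : ∀ z ∈ O, X z ≠ 0) :
    ∃ c : E n → ℝ, ContDiffOn ℝ ∞ (fun z => c z • X z) O ∧ (∀ z ∈ O, c z ≠ 0) ∧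
      ∀ z ∈ O, B z (c z • X z) (c z • X z) = 1 := by
  have hpos : ∀ z ∈ O, 0 < B z (X z) (X z) := fun z hz => hB.pos z hz _ (h0 z hz)
  have hs : ∀ z ∈ O, √(B z (X z) (X z)) ≠ 0 := fun z hz => (Real.sqrt_pos.2 (hpos z hz)).ne'
  refine ⟨fun z => (√(B z (X z) (X z)))⁻¹, ?_, fun z hz => inv_ne_zero (hs z hz), fun z hz => ?_⟩
  · exact (((hB.contDiffOn_apply hX hX).sqrt fun z hz => (hpos z hz).ne').inv hs).smul hX
  · have := Real.mul_self_sqrt (hpos z hz).le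
    simp only [map_smul, smul_apply, smul_eq_mul]
    have h := hs z hz
    rw [← mul_assoc, ← mul_inv, this, inv_mul_cancel₀ (hpos z hz).ne']

/-- Gram–Schmidt applied to the two coordinate fields. -/
theorem exists_frame {B : E 2 → E 2 →L[ℝ] E 2 →L[ℝ] ℝ} {O : Set (E 2)} (hB : IsMetricOn B O) :
    ∃ e, IsFrameOn B e O := by
  have hc : ∀ i : Fin 2, (coordVec i : E 2) ≠ 0 := fun i => by simp [coordVec]
  obtain ⟨c, hc1, hc2, hc3⟩ := hB.exists_normalize
    (X := fun _ => (coordVec 0 : E 2)) contDiffOn_const fun z _ => hc 0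
  set X : E 2 → E 2 := fun z => c z • coordVec 0
  set Y : E 2 → E 2 := fun z => coordVec 1 - B z (coordVec 1) (X z) • X z with hY
  -- The component of `Y` with index 1 is 1, as `X` is a multiple of `coordVec 0`.
  have hY0 : ∀ z ∈ O, Y z ≠ 0 := fun z _ h => by
    have := congrArg (fun v : E 2 => v 1) h
    simp [hY, X, coordVec] at this
  have hXY : ∀ z ∈ O, B z (X z) (Y z) = 0 := fun z hz => by
    simp only [hY, map_sub, map_smul, smul_eq_mul]
    rw [hc3 z hz, hB.symm z hz]
    ring
  obtain ⟨d, hd1, -, hd3⟩ := hB.exists_normalize (X := Y)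
    (contDiffOn_const.sub ((hB.contDiffOn_apply contDiffOn_const hc1).smul hc1)) hY0
  refine ⟨![X, fun z => d z • Y z], ⟨fun a => ?_, fun z hz a b => ?_⟩⟩
  · fin_cases a
    · exact hc1
    · exact hd1
  · fin_cases a <;> fin_cases b
    · exact hc3 z hz
    · simp [hXY z hz]
    · simp [hXY z hz, hB.symm z hz (Y z)]
    · exact hd3 z hz

end IsMetricOn

/-! ### Gauss curvature of a surface in an orthonormal frame -/

namespace IsFrameOn

variable {B : E n → E n →L[ℝ] E n →L[ℝ] ℝ} {O : Set (E n)} {y : E n} {e : Fin n → E n → E n}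

theorem fderiv_conn_skew (he : IsFrameOn B e O) (hB : IsMetricOn B O) (hy : y ∈ O)
    (a b c : Fin n) : fderiv ℝ (conn B e a c b) y = - fderiv ℝ (conn B e a b c) y := by
  rw [fderiv_congr_on hB.isOpen (fun z hz => he.conn_skew hB hz a b c) hy, fderiv_fun_neg]

theorem conn_self (he : IsFrameOn B e O) (hB : IsMetricOn B O) (hy : y ∈ O) (a b : Fin n) :
    conn B e a b b y = 0 := by
  have := he.conn_skew hB hy a b b
  linarith

theorem riem_frame_skew (he : IsFrameOn B e O) (hB : IsMetricOn B O) (hy : y ∈ O)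
    (a b c d : Fin n) :
    B y (riem B y (e a y) (e b y) (e d y)) (e c y) =
      - B y (riem B y (e a y) (e b y) (e c y)) (e d y) := by
  rw [he.riem_frame hB hy, he.riem_frame hB hy, he.fderiv_conn_skew hB hy b c d,
    he.fderiv_conn_skew hB hy a c d]
  simp only [he.conn_skew hB hy _ c d, neg_apply]
  have h : ∀ f, conn B e b d f y * conn B e a c f y - conn B e a d f y * conn B e b c f y
      + struc B e a b f y * - conn B e f c d y =
      -(conn B e b c f y * conn B e a d f y - conn B e a c f y * conn B e b d f y
      + struc B e a b f y * conn B e f c d y) := fun f => by ring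
  simp only [h, Finset.sum_neg_distrib]
  ring

/-- Curvature is alternating in each pair of arguments, so a change of basis multiplies it by the
square of the determinant, and the Gram determinant is the same square. -/
theorem gaussCurvature_eq {B : E 2 → E 2 →L[ℝ] E 2 →L[ℝ] ℝ} {O : Set (E 2)} {y : E 2}
    {e : Fin 2 → E 2 → E 2} (he : IsFrameOn B e O) (hB : IsMetricOn B O) (hy : y ∈ O) :
    gaussCurvature (toForm B) y = B y (riem B y (e 0 y) (e 1 y) (e 1 y)) (e 0 y) := by
  have hv := he.orthonormal y hy
  have h0 := IsMetricOn.sum_apply_smul hv (coordVec 0)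
  have h1 := IsMetricOn.sum_apply_smul hv (coordVec 1)
  rw [Fin.sum_univ_two] at h0 h1
  have hg := hB.det_gram_ne_zero hy
  rw [gaussCurvature, hB.curvature_eq hy, div_eq_iff hg]
  rw [Matrix.det_fin_two]
  simp only [gram, Matrix.of_apply, toForm]
  generalize B y (coordVec 0) (e 0 y) = p at h0
  generalize B y (coordVec 0) (e 1 y) = q at h0
  generalize B y (coordVec 1) (e 0 y) = r at h1
  generalize B y (coordVec 1) (e 1 y) = s at h1
  have hs : ∀ w x, B y (riem B y (e 0 y) (e 0 y) w) x = 0 := fun w x => by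
    simp [riem]
  have hs' : ∀ w x, B y (riem B y (e 1 y) (e 1 y) w) x = 0 := fun w x => by
    simp [riem]
  have k00 := he.riem_frame_skew hB hy 0 1 0 0
  have k11 := he.riem_frame_skew hB hy 0 1 1 1
  have k01 := he.riem_frame_skew hB hy 0 1 1 0
  rw [← h0, ← h1]
  simp only [(isLinearMap_riem_left B y _ _).map_add, (isLinearMap_riem_left B y _ _).map_smul,
    (isLinearMap_riem_middle B y _ _).map_add, (isLinearMap_riem_middle B y _ _).map_smul,
    (isLinearMap_riem_right B y _ _).map_add, (isLinearMap_riem_right B y _ _).map_smul,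
    riem_swap B y (e 0 y) (e 1 y), map_add, map_smul, map_neg, add_apply, smul_apply, neg_apply,
    smul_eq_mul, hs, hs', hv]
  simp only [Fin.isValue, if_true, show (0 : Fin 2) ≠ 1 by decide, show (1 : Fin 2) ≠ 0 by decide,
    if_false]
  -- `k00` and `k11` kill the terms with repeated last arguments (each reads `x = -x`, hence the
  -- halves); `k01` swaps the last two.
  linear_combination (p * s - q * r) * (r * p / 2 * k00 + s * q / 2 * k11 + r * q * k01)

end IsFrameOn

theorem struc_self (B : E n → E n →L[ℝ] E n →L[ℝ] ℝ) (e : Fin n → E n → E n) (a c : Fin n)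
    (z : E n) : struc B e a a c z = 0 := by
  simp [struc]

/-- In dimension two the Koszul formula identifies both independent connection coefficients with
structure functions. -/
theorem IsFrameOn.gaussCurvature_eq_struc {B : E 2 → E 2 →L[ℝ] E 2 →L[ℝ] ℝ} {O : Set (E 2)}
    {y : E 2} {e : Fin 2 → E 2 → E 2} (he : IsFrameOn B e O) (hB : IsMetricOn B O) (hy : y ∈ O) :
    gaussCurvature (toForm B) y =
      fderiv ℝ (struc B e 0 1 1) y (e 0 y) - fderiv ℝ (struc B e 0 1 0) y (e 1 y)
        - struc B e 0 1 0 y ^ 2 - struc B e 0 1 1 y ^ 2 := by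
  have h0 : ∀ z ∈ O, conn B e 0 1 0 z = struc B e 0 1 0 z := fun z hz => by
    rw [he.conn_eq hB hz, struc_swap B e 0 1, struc_self]; ring
  have h1 : ∀ z ∈ O, conn B e 1 1 0 z = struc B e 0 1 1 z := fun z hz => by
    rw [he.conn_eq hB hz, struc_swap B e 0 1, struc_self]; ring
  rw [he.gaussCurvature_eq hB hy, he.riem_frame hB hy, fderiv_congr_on hB.isOpen h0 hy,
    fderiv_congr_on hB.isOpen h1 hy]
  simp only [Fin.sum_univ_two, he.conn_self hB hy, h0 y hy, h1 y hy]
  have h01 := he.conn_skew hB hy 0 0 1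
  ring

/-! ### Semi-conformal submersions on open sets: the adapted frame and its brackets -/

/-- The derivative of a map applied to a Lie bracket. -/
theorem fderiv_lieBracket {m : ℕ} {O : Set (E n)} (hO : IsOpen O) {F : E n → E m}
    (hF : ContDiffOn ℝ ∞ F O) {X Y : E n → E n} (hX : ContDiffOn ℝ ∞ X O)
    (hY : ContDiffOn ℝ ∞ Y O) {y : E n} (hy : y ∈ O) :
    fderiv ℝ F y (VectorField.lieBracket ℝ X Y y) =
      fderiv ℝ (fun z => fderiv ℝ F z (Y z)) y (X y)
        - fderiv ℝ (fun z => fderiv ℝ F z (X z)) y (Y y) := by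
  have hd := differentiableAt_of_contDiffOn hO (contDiffOn_fderiv hO hF) hy
  have hs : IsSymmSndFDerivAt ℝ F y := (hF.contDiffAt (hO.mem_nhds hy)).isSymmSndFDerivAt (by
    rw [minSmoothness_of_isRCLikeNormedField]; exact WithTop.coe_le_coe.2 le_top)
  rw [fderiv_clm_apply hd (differentiableAt_of_contDiffOn hO hX hy),
    fderiv_clm_apply hd (differentiableAt_of_contDiffOn hO hY hy), VectorField.lieBracket]
  simp [hs (X y) (Y y)]

/-- A semi-conformal submersion `F` from `(O, B)` to `(O', H)` with dilation `lam` and unit vertical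
vector field `V`, for open subsets `O` of `ℝ³` and `O'` of `ℝ²`. -/
structure IsLocalSubmersion (B : E 3 → E 3 →L[ℝ] E 3 →L[ℝ] ℝ) (O : Set (E 3))
    (H : E 2 → E 2 →L[ℝ] E 2 →L[ℝ] ℝ) (O' : Set (E 2)) (F : E 3 → E 2) (lam : E 3 → ℝ)
    (V : E 3 → E 3) : Prop where
  metric : IsMetricOn B O
  metric' : IsMetricOn H O'
  mapsTo : ∀ z ∈ O, F z ∈ O'
  contDiffOn : ContDiffOn ℝ ∞ F O
  contDiffOn_field : ContDiffOn ℝ ∞ V O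
  surjective : ∀ z ∈ O, Function.Surjective (fderiv ℝ F z)
  pos : ∀ z ∈ O, 0 < lam z
  vertical : ∀ z ∈ O, fderiv ℝ F z (V z) = 0
  unit : ∀ z ∈ O, B z (V z) (V z) = 1
  conformal : ∀ z ∈ O, ∀ u v, B z u (V z) = 0 → B z v (V z) = 0 →
    lam z ^ 2 * B z u v = H (F z) (fderiv ℝ F z u) (fderiv ℝ F z v)

/-- The horizontal field `λ X`, where `X` is the horizontal lift of `f`. -/
def scaledLift (B : E 3 → E 3 →L[ℝ] E 3 →L[ℝ] ℝ) (H : E 2 → E 2 →L[ℝ] E 2 →L[ℝ] ℝ)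
    (F : E 3 → E 2) (lam : E 3 → ℝ) (f : E 2 → E 2) (z : E 3) : E 3 :=
  sharp (toForm B) z ⇑((lam z)⁻¹ • (H (F z) (f (F z))).comp (fderiv ℝ F z))

namespace IsLocalSubmersion

variable {B : E 3 → E 3 →L[ℝ] E 3 →L[ℝ] ℝ} {O : Set (E 3)}
  {H : E 2 → E 2 →L[ℝ] E 2 →L[ℝ] ℝ} {O' : Set (E 2)} {F : E 3 → E 2} {lam : E 3 → ℝ}
  {V : E 3 → E 3} {y : E 3}

theorem conformal_eq (h : IsLocalSubmersion B O H O' F lam V) (hy : y ∈ O) (u v : E 3) :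
    lam y ^ 2 * (B y u v - B y u (V y) * B y v (V y)) =
      H (F y) (fderiv ℝ F y u) (fderiv ℝ F y v) := by
  have hh : ∀ w, B y (w - B y w (V y) • V y) (V y) = 0 := fun w => by simp [h.unit y hy]
  have := h.conformal y hy _ _ (hh u) (hh v)
  simp only [map_sub, map_smul, h.vertical y hy, smul_zero, sub_zero] at this
  rw [← this]
  simp only [sub_apply, smul_apply, smul_eq_mul, h.unit y hy, h.metric.symm y hy (V y) v]
  ring

/-- Smoothness of `lam` is a consequence of conformality: for a constant field `w` not vertical at
`y`, `lam ^ 2` is near `y` a quotient of smooth functions, and `lam > 0` selects the root. -/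
theorem contDiffOn_dilation (h : IsLocalSubmersion B O H O' F lam V) : ContDiffOn ℝ ∞ lam O := by
  intro y hy
  have hO := h.metric.isOpen
  obtain ⟨w, hw⟩ := h.surjective y hy (coordVec 0)
  set p : E 3 → ℝ := fun z => B z w w - B z w (V z) * B z w (V z)
  set q : E 3 → ℝ := fun z => H (F z) (fderiv ℝ F z w) (fderiv ℝ F z w)
  have hpq : ∀ z ∈ O, lam z ^ 2 * p z = q z := fun z hz => h.conformal_eq hz w w
  have hp : ContDiffOn ℝ ∞ p O :=
    (h.metric.contDiffOn_apply contDiffOn_const contDiffOn_const).sub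
      ((h.metric.contDiffOn_apply contDiffOn_const h.contDiffOn_field).mul
        (h.metric.contDiffOn_apply contDiffOn_const h.contDiffOn_field))
  have hdF : ContDiffOn ℝ ∞ (fun z => fderiv ℝ F z w) O :=
    (contDiffOn_fderiv hO h.contDiffOn).clm_apply contDiffOn_const
  have hq : ContDiffOn ℝ ∞ q O :=
    ((h.metric'.contDiffOn.comp h.contDiffOn h.mapsTo).clm_apply hdF).clm_apply hdF
  have hqy : 0 < q y := h.metric'.pos _ (h.mapsTo y hy) _ (by rw [hw]; simp [coordVec])
  have hpy : p y ≠ 0 := fun h0 => by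
    have := hpq y hy
    rw [h0, mul_zero] at this
    exact hqy.ne this
  have hd : ContDiffWithinAt ℝ ∞ (fun z => √(q z / p z)) O y := by
    refine ((hq y hy).div (hp y hy) hpy).sqrt ?_
    exact div_ne_zero hqy.ne' hpy
  refine hd.congr_of_eventuallyEq ?_ ?_
  · filter_upwards [(hp y hy).continuousWithinAt.eventually_ne hpy, self_mem_nhdsWithin] with z hz hzO
    rw [← hpq z hzO, mul_div_assoc, div_self hz, mul_one, Real.sqrt_sq (h.pos z hzO).le]
  · rw [← hpq y hy, mul_div_assoc, div_self hpy, mul_one, Real.sqrt_sq (h.pos y hy).le]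

variable {f : E 2 → E 2}

theorem contDiffOn_scaledLift (h : IsLocalSubmersion B O H O' F lam V)
    (hf : ContDiffOn ℝ ∞ f O') : ContDiffOn ℝ ∞ (scaledLift B H F lam f) O := by
  refine h.metric.contDiffOn_sharp ?_
  refine (h.contDiffOn_dilation.inv fun z hz => (h.pos z hz).ne').smul ?_
  exact ((h.metric'.contDiffOn.comp h.contDiffOn h.mapsTo).clm_apply
    (hf.comp h.contDiffOn h.mapsTo)).clm_comp (contDiffOn_fderiv h.metric.isOpen h.contDiffOn)

theorem apply_scaledLift (h : IsLocalSubmersion B O H O' F lam V) (hy : y ∈ O) (f : E 2 → E 2)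
    (w : E 3) :
    B y (scaledLift B H F lam f y) w = (lam y)⁻¹ * H (F y) (f (F y)) (fderiv ℝ F y w) := by
  rw [scaledLift, h.metric.apply_sharp hy]
  simp

theorem scaledLift_horizontal (h : IsLocalSubmersion B O H O' F lam V) (hy : y ∈ O)
    (f : E 2 → E 2) : B y (scaledLift B H F lam f y) (V y) = 0 := by
  rw [h.apply_scaledLift hy, h.vertical y hy]
  simp

/-- Tested against `dF w`, which is every vector by surjectivity; conformality turns the pairing
into the one defining `scaledLift`. -/
theorem fderiv_scaledLift (h : IsLocalSubmersion B O H O' F lam V) (hy : y ∈ O)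
    (f : E 2 → E 2) : fderiv ℝ F y (scaledLift B H F lam f y) = lam y • f (F y) := by
  refine h.metric'.ext (h.mapsTo y hy) fun w' => ?_
  obtain ⟨w, rfl⟩ := h.surjective y hy w'
  have h0 := (h.pos y hy).ne'
  rw [← h.conformal_eq hy, h.scaledLift_horizontal hy, h.apply_scaledLift hy]
  simp only [map_smul, smul_apply, smul_eq_mul]
  field_simp
  ring

/-- The orthonormal frame given by the scaled horizontal lifts of an orthonormal frame, and `V`. -/
def frame (B : E 3 → E 3 →L[ℝ] E 3 →L[ℝ] ℝ) (H : E 2 → E 2 →L[ℝ] E 2 →L[ℝ] ℝ)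
    (F : E 3 → E 2) (lam : E 3 → ℝ) (V : E 3 → E 3) (f : Fin 2 → E 2 → E 2) : Fin 3 → E 3 → E 3 :=
  ![scaledLift B H F lam (f 0), scaledLift B H F lam (f 1), V]

variable {f : Fin 2 → E 2 → E 2}

theorem isFrameOn (h : IsLocalSubmersion B O H O' F lam V) (hf : IsFrameOn H f O') :
    IsFrameOn B (frame B H F lam V f) O := by
  have hl := fun i => h.contDiffOn_scaledLift (hf.contDiffOn i)
  have key : ∀ z ∈ O, ∀ i j, B z (scaledLift B H F lam (f i) z) (scaledLift B H F lam (f j) z) =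
      if i = j then 1 else 0 := fun z hz i j => by
    rw [h.apply_scaledLift hz, h.fderiv_scaledLift hz, map_smul, smul_eq_mul,
      hf.orthonormal _ (h.mapsTo z hz), ← mul_assoc, inv_mul_cancel₀ (h.pos z hz).ne', one_mul]
  have hV : ∀ z ∈ O, ∀ i, B z (scaledLift B H F lam (f i) z) (V z) = 0 :=
    fun z hz i => h.scaledLift_horizontal hz (f i)
  constructor
  · intro a
    fin_cases a
    exacts [hl 0, hl 1, h.contDiffOn_field]
  · intro z hz a b
    have hs := fun u => h.metric.symm z hz (V z) u
    fin_cases a <;> fin_cases b <;>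
      simp [frame, key z hz, hV z hz, h.unit z hz, hs]

/-- The Lie bracket of fields `X`, `Y` whose images under `dF` are `c p` and `d q`. -/
theorem fderiv_lieBracket_of_related (h : IsLocalSubmersion B O H O' F lam V) (hy : y ∈ O)
    {X Y : E 3 → E 3} (hX : ContDiffOn ℝ ∞ X O) (hY : ContDiffOn ℝ ∞ Y O)
    {c d : E 3 → ℝ} {p q : E 2 → E 2} (hc : ContDiffOn ℝ ∞ c O) (hd : ContDiffOn ℝ ∞ d O)
    (hp : ContDiffOn ℝ ∞ p O') (hq : ContDiffOn ℝ ∞ q O')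
    (hFX : ∀ z ∈ O, fderiv ℝ F z (X z) = c z • p (F z))
    (hFY : ∀ z ∈ O, fderiv ℝ F z (Y z) = d z • q (F z)) :
    fderiv ℝ F y (VectorField.lieBracket ℝ X Y y) =
      fderiv ℝ d y (X y) • q (F y) - fderiv ℝ c y (Y y) • p (F y)
        + (c y * d y) • VectorField.lieBracket ℝ p q (F y) := by
  have hO := h.metric.isOpen
  have hF := differentiableAt_of_contDiffOn hO h.contDiffOn hy
  have key : ∀ {c : E 3 → ℝ} {p : E 2 → E 2}, ContDiffOn ℝ ∞ c O → ContDiffOn ℝ ∞ p O' →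
      ∀ u, fderiv ℝ (fun z => c z • p (F z)) y u =
        c y • fderiv ℝ p (F y) (fderiv ℝ F y u) + fderiv ℝ c y u • p (F y) :=
    fun {c p} hc hp u => by
      have hp' := differentiableAt_of_contDiffOn h.metric'.isOpen hp (h.mapsTo y hy)
      have := (differentiableAt_of_contDiffOn hO hc hy).hasFDerivAt.smul
        (hp'.hasFDerivAt.comp y hF.hasFDerivAt)
      have h2 := this.fderiv
      simp only [Function.comp_def] at h2
      change fderiv ℝ ((fun z => c z) • fun z => p (F z)) y u = _
      rw [h2]
      simp
  rw [fderiv_lieBracket hO h.contDiffOn hX hY hy, fderiv_congr_on hO hFX hy,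
    fderiv_congr_on hO hFY hy, key hc hp, key hd hq, hFX y hy, hFY y hy,
    VectorField.lieBracket]
  simp only [map_smul]
  module

theorem fderiv_log_dilation (h : IsLocalSubmersion B O H O' F lam V) (hy : y ∈ O) (u : E 3) :
    fderiv ℝ (fun z => Real.log (lam z)) y u = (lam y)⁻¹ * fderiv ℝ lam y u := by
  rw [fderiv.log (differentiableAt_of_contDiffOn h.metric.isOpen h.contDiffOn_dilation hy)
    (h.pos y hy).ne']
  simp

theorem contDiffOn_log_dilation (h : IsLocalSubmersion B O H O' F lam V) :
    ContDiffOn ℝ ∞ (fun z => Real.log (lam z)) O :=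
  h.contDiffOn_dilation.log fun z hz => (h.pos z hz).ne'

/-- Pairing with a scaled lift depends only on the image under `dF`, and `dF [e 0, e 1] = e 0(λ) f 1
- e 1(λ) f 0 + λ² [f 0, f 1]`. -/
theorem struc_horizontal (h : IsLocalSubmersion B O H O' F lam V) (hf : IsFrameOn H f O')
    (hy : y ∈ O) (i : Fin 2) :
    struc B (frame B H F lam V f) 0 1 i.castSucc y =
      lam y * struc H f 0 1 i (F y)
        + fderiv ℝ (fun z => Real.log (lam z)) y (frame B H F lam V f 0 y)
          * (if i = 1 then 1 else 0)
        - fderiv ℝ (fun z => Real.log (lam z)) y (frame B H F lam V f 1 y)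
          * (if i = 0 then 1 else 0) := by
  have hi : frame B H F lam V f i.castSucc = scaledLift B H F lam (f i) := by
    fin_cases i <;> rfl
  have ho := hf.orthonormal _ (h.mapsTo y hy)
  rw [struc, hi, h.metric.symm y hy, h.apply_scaledLift hy,
    h.fderiv_lieBracket_of_related hy ((h.isFrameOn hf).contDiffOn 0) ((h.isFrameOn hf).contDiffOn 1)
      h.contDiffOn_dilation h.contDiffOn_dilation (hf.contDiffOn 0) (hf.contDiffOn 1)
      (fun z hz => h.fderiv_scaledLift hz _) (fun z hz => h.fderiv_scaledLift hz _)]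
  simp only [map_add, map_sub, map_smul, smul_eq_mul, ho, h.fderiv_log_dilation hy, struc]
  rw [h.metric'.symm _ (h.mapsTo y hy) (f i (F y))]
  have h0 := (h.pos y hy).ne'
  field_simp
  ring

/-- Infinitesimal conformality of the fibres: `dF [V, e i] = V(λ) f i`. -/
theorem struc_vertical (h : IsLocalSubmersion B O H O' F lam V) (hf : IsFrameOn H f O')
    (hy : y ∈ O) (i j : Fin 2) :
    struc B (frame B H F lam V f) 2 i.castSucc j.castSucc y =
      fderiv ℝ (fun z => Real.log (lam z)) y (V y) * (if i = j then 1 else 0) := by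
  have hi : ∀ i : Fin 2, frame B H F lam V f i.castSucc = scaledLift B H F lam (f i) := fun i => by
    fin_cases i <;> rfl
  have h2 : frame B H F lam V f 2 = V := rfl
  have ho := hf.orthonormal _ (h.mapsTo y hy)
  -- `V` is related to zero, written as `0 • f 0`; the choice of `f 0` is immaterial.
  rw [struc, hi, hi, h2, h.metric.symm y hy, h.apply_scaledLift hy,
    h.fderiv_lieBracket_of_related hy (c := fun _ => 0) (p := f 0) h.contDiffOn_field
      (h.contDiffOn_scaledLift (hf.contDiffOn i))
      contDiffOn_const h.contDiffOn_dilation (hf.contDiffOn 0) (hf.contDiffOn i)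
      (fun z hz => by rw [h.vertical z hz, zero_smul]) (fun z hz => h.fderiv_scaledLift hz _)]
  simp only [map_add, map_sub, map_smul, smul_eq_mul, ho, h.fderiv_log_dilation hy]
  simp only [fderiv_fun_const, Pi.zero_apply, zero_apply, eq_comm (a := j)]
  ring

end IsLocalSubmersion

/-! ### Mean curvature and integrability tensor of a unit field -/

namespace IsMetricOn

variable {B : E n → E n →L[ℝ] E n →L[ℝ] ℝ} {O : Set (E n)} {y : E n} {V : E n → E n}

theorem nabla_unit (hB : IsMetricOn B O) (hy : y ∈ O) (hV : ContDiffOn ℝ ∞ V O)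
    (h1 : ∀ z ∈ O, B z (V z) (V z) = 1) (u : E n) : B y (nabla B V y u) (V y) = 0 := by
  have h := hB.fderiv_apply hy hV hV u
  rw [fderiv_congr_on hB.isOpen h1 hy, hB.symm y hy (V y)] at h
  simp only [fderiv_fun_const, Pi.zero_apply, zero_apply] at h
  linarith

theorem meanCurvature_eq (hB : IsMetricOn B O) (hy : y ∈ O) (hV : ContDiffOn ℝ ∞ V O)
    (h1 : ∀ z ∈ O, B z (V z) (V z) = 1) :
    meanCurvature (toForm B) V y = nabla B V y (V y) := by
  simp [meanCurvature, horiz, vert, hB.cov_eq hy, hB.nabla_unit hy hV h1]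

/-- For horizontal `X`, `Y` one has `dθ(X, Y) = -θ([X, Y])`, because `θ(X)` and `θ(Y)` vanish
identically. -/
theorem integrability_eq (hB : IsMetricOn B O) (hy : y ∈ O) (hV : ContDiffOn ℝ ∞ V O)
    (h1 : ∀ z ∈ O, B z (V z) (V z) = 1) (u v : E n) :
    integrability (toForm B) V y u v =
      (- dFlat B V y (u - B y u (V y) • V y) (v - B y v (V y) • V y)) • V y := by
  set X : E n → E n → E n := fun w z => w - B z w (V z) • V z with hX
  have hXs : ∀ w, ContDiffOn ℝ ∞ (X w) O := fun w =>
    contDiffOn_const.sub ((hB.contDiffOn_apply contDiffOn_const hV).smul hV)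
  have hXV : ∀ w, ∀ z ∈ O, B z (X w z) (V z) = 0 := fun w z hz => by simp [hX, h1 z hz]
  have h0 : ∀ w x, B y (nabla B (X w) y x) (V y) = - B y (nabla B V y x) (X w y) := fun w x => by
    have := hB.fderiv_apply hy (hXs w) hV x
    rw [fderiv_congr_on hB.isOpen (hXV w) hy, hB.symm y hy (X w y)] at this
    simp only [fderiv_fun_const, Pi.zero_apply, zero_apply] at this
    linarith
  change B y (VectorField.lieBracket ℝ (X u) (X v) y) (V y) • V y = _
  congr 1
  rw [← hB.nabla_sub_nabla hy, map_sub, sub_apply, h0, h0, dFlat_apply]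
  ring

theorem integrabilityNormSq_eq (hB : IsMetricOn B O) (hy : y ∈ O) (hV : ContDiffOn ℝ ∞ V O)
    (h1 : ∀ z ∈ O, B z (V z) (V z) = 1) {e : Fin n → E n}
    (he : ∀ a b, B y (e a) (e b) = if a = b then 1 else 0) :
    integrabilityNormSq (toForm B) V y =
      ∑ a, ∑ b, dFlat B V y (e a - B y (e a) (V y) • V y) (e b - B y (e b) (V y) • V y) ^ 2 := by
  have hf : ∀ u v u' v', toForm B y (integrability (toForm B) V y u v)
      (integrability (toForm B) V y u' v') =
      dFlat B V y (u - B y u (V y) • V y) (v - B y v (V y) • V y) *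
      dFlat B V y (u' - B y u' (V y) • V y) (v' - B y v' (V y) • V y) := fun u v u' v' => by
    rw [hB.integrability_eq hy hV h1, hB.integrability_eq hy hV h1]
    simp only [toForm, map_smul, smul_apply, smul_eq_mul, h1 y hy]
    ring
  have hi : ∀ u u', metricTrace (toForm B) y (fun v v' =>
      toForm B y (integrability (toForm B) V y u v) (integrability (toForm B) V y u' v')) =
      ∑ b, dFlat B V y (u - B y u (V y) • V y) (e b - B y (e b) (V y) • V y) *
        dFlat B V y (u' - B y u' (V y) • V y) (e b - B y (e b) (V y) • V y) := fun u u' => by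
    simp only [hf]
    rw [hB.metricTrace_eq hy he]
    · exact fun w => ⟨fun a b => by simp; ring, fun c a => by simp; ring⟩
    · exact fun w => ⟨fun a b => by simp; ring, fun c a => by simp; ring⟩
  rw [integrabilityNormSq]
  simp only [hi]
  rw [hB.metricTrace_eq hy he]
  · simp only [sq]
  · refine fun w => ⟨fun a b => ?_, fun c a => ?_⟩
    · rw [← Finset.sum_add_distrib]
      exact Finset.sum_congr rfl fun b _ => by simp; ring
    · rw [smul_eq_mul, Finset.mul_sum]
      exact Finset.sum_congr rfl fun b _ => by simp; ring
  · refine fun w => ⟨fun a b => ?_, fun c a => ?_⟩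
    · rw [← Finset.sum_add_distrib]
      exact Finset.sum_congr rfl fun b _ => by simp; ring
    · rw [smul_eq_mul, Finset.mul_sum]
      exact Finset.sum_congr rfl fun b _ => by simp; ring

theorem isLinearMap_ricci_left (hB : IsMetricOn B O) (hy : y ∈ O) (w : E n) :
    IsLinearMap ℝ fun v => ricci (toForm B) y v w := by
  simp only [ricci, hB.curvature_eq hy]
  refine ⟨fun a b => ?_, fun c a => ?_⟩
  · rw [← Finset.sum_add_distrib]
    exact Finset.sum_congr rfl fun i _ => by rw [(isLinearMap_riem_middle B y _ w).map_add]; simp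
  · rw [smul_eq_mul, Finset.mul_sum]
    exact Finset.sum_congr rfl fun i _ => by rw [(isLinearMap_riem_middle B y _ w).map_smul]; simp

theorem isLinearMap_ricci_right (hB : IsMetricOn B O) (hy : y ∈ O) (v : E n) :
    IsLinearMap ℝ (ricci (toForm B) y v) := by
  have : ricci (toForm B) y v = fun w => ∑ i, riem B y (coordVec i) v w i := by
    funext w
    simp only [ricci, hB.curvature_eq hy]
  rw [this]
  refine ⟨fun a b => ?_, fun c a => ?_⟩
  · rw [← Finset.sum_add_distrib]
    exact Finset.sum_congr rfl fun i _ => by rw [(isLinearMap_riem_right B y _ v).map_add]; simp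
  · rw [smul_eq_mul, Finset.mul_sum]
    exact Finset.sum_congr rfl fun i _ => by rw [(isLinearMap_riem_right B y _ v).map_smul]; simp

end IsMetricOn

/-! ### Connection coefficients of the adapted frame and the curvature of the base -/

namespace IsLocalSubmersion

variable {B : E 3 → E 3 →L[ℝ] E 3 →L[ℝ] ℝ} {O : Set (E 3)}
  {H : E 2 → E 2 →L[ℝ] E 2 →L[ℝ] ℝ} {O' : Set (E 2)} {F : E 3 → E 2} {lam : E 3 → ℝ}
  {V : E 3 → E 3} {y : E 3} {f : Fin 2 → E 2 → E 2}

theorem conn_002 (h : IsLocalSubmersion B O H O' F lam V) (hf : IsFrameOn H f O') (hy : y ∈ O) :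
    conn B (frame B H F lam V f) 0 0 2 y = fderiv ℝ (fun z => Real.log (lam z)) y (V y) := by
  have h1 := h.struc_vertical hf hy 0 0
  simp only [Fin.castSucc_zero, if_true] at h1
  rw [(h.isFrameOn hf).conn_eq h.metric hy, struc_self, struc_swap B _ 2 0, h1]
  ring

theorem conn_112 (h : IsLocalSubmersion B O H O' F lam V) (hf : IsFrameOn H f O') (hy : y ∈ O) :
    conn B (frame B H F lam V f) 1 1 2 y = conn B (frame B H F lam V f) 0 0 2 y := by
  have h1 := h.struc_vertical hf hy 1 1
  simp only [Fin.castSucc_one, if_true] at h1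
  rw [h.conn_002 hf hy, (h.isFrameOn hf).conn_eq h.metric hy, struc_self, struc_swap B _ 2 1, h1]
  ring

/-- `[V, e 0]` has no `e 1` component and `[V, e 1]` no `e 0` component, so in the Koszul formula
only `g([e 0, e 1], V)` survives. The same holds for `conn_102`. -/
theorem conn_201 (h : IsLocalSubmersion B O H O' F lam V) (hf : IsFrameOn H f O') (hy : y ∈ O) :
    conn B (frame B H F lam V f) 2 0 1 y = - conn B (frame B H F lam V f) 0 1 2 y := by
  have h1 := h.struc_vertical hf hy 1 0
  have h2 := h.struc_vertical hf hy 0 1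
  simp only [Fin.castSucc_one, Fin.castSucc_zero, one_ne_zero, zero_ne_one, if_false] at h1 h2
  rw [(h.isFrameOn hf).conn_eq h.metric hy, (h.isFrameOn hf).conn_eq h.metric hy,
    struc_swap B _ 2 1, h1, h2]
  ring

theorem conn_102 (h : IsLocalSubmersion B O H O' F lam V) (hf : IsFrameOn H f O') (hy : y ∈ O) :
    conn B (frame B H F lam V f) 1 0 2 y = - conn B (frame B H F lam V f) 0 1 2 y := by
  have h1 := h.struc_vertical hf hy 1 0
  have h2 := h.struc_vertical hf hy 0 1
  simp only [Fin.castSucc_one, Fin.castSucc_zero, one_ne_zero, zero_ne_one, if_false] at h1 h2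
  rw [(h.isFrameOn hf).conn_eq h.metric hy, (h.isFrameOn hf).conn_eq h.metric hy,
    struc_swap B _ 2 1, struc_swap B _ 2 0, struc_swap B _ 0 1, h1, h2]
  ring

/-- The Gauss curvature of the base in terms of the connection coefficients of the total space. -/
theorem dilation_sq_mul_gaussCurvature (h : IsLocalSubmersion B O H O' F lam V)
    (hf : IsFrameOn H f O') (hy : y ∈ O) {e : Fin 3 → E 3 → E 3} (he : e = frame B H F lam V f)
    {L : E 3 → ℝ} (hL : L = fun z => Real.log (lam z)) :
    lam y ^ 2 * gaussCurvature (toForm H) (F y) =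
      - fderiv ℝ (conn B e 1 0 1) y (e 0 y) - fderiv ℝ (fun z => fderiv ℝ L z (e 0 z)) y (e 0 y)
      + fderiv ℝ L y (e 0 y) * (conn B e 1 0 1 y + fderiv ℝ L y (e 0 y))
      + fderiv ℝ (conn B e 0 0 1) y (e 1 y) - fderiv ℝ (fun z => fderiv ℝ L z (e 1 z)) y (e 1 y)
      + fderiv ℝ L y (e 1 y) * (fderiv ℝ L y (e 1 y) - conn B e 0 0 1 y)
      - (fderiv ℝ L y (e 1 y) - conn B e 0 0 1 y) ^ 2
      - (conn B e 1 0 1 y + fderiv ℝ L y (e 0 y)) ^ 2 := by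
  have hO := h.metric.isOpen
  have hfr := h.isFrameOn hf
  rw [← he] at hfr
  have hLs : ContDiffOn ℝ ∞ L O := hL ▸ h.contDiffOn_log_dilation
  have hdL : ∀ i, ContDiffOn ℝ ∞ (fun z => fderiv ℝ L z (e i z)) O := fun i =>
    (contDiffOn_fderiv hO hLs).clm_apply (hfr.contDiffOn i)
  -- Valid on all of `O`, so `ha` and `hb` can be differentiated; `dF (e i) = λ f i` then supplies
  -- the second factor `λ`.
  have ha : ∀ z ∈ O, lam z * struc H f 0 1 0 (F z) =
      fderiv ℝ L z (e 1 z) - conn B e 0 0 1 z := fun z hz => by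
    have h1 := h.struc_horizontal hf hz 0
    have h2 := IsFrameOn.conn_sub_conn h.metric hz e 0 1 0
    rw [hfr.conn_self h.metric hz, hfr.conn_skew h.metric hz 0 0 1] at h2
    simp only [Fin.castSucc_zero, zero_ne_one, if_false, if_true, ← he, ← hL] at h1
    linarith
  have hb : ∀ z ∈ O, lam z * struc H f 0 1 1 (F z) =
      - conn B e 1 0 1 z - fderiv ℝ L z (e 0 z) := fun z hz => by
    have h1 := h.struc_horizontal hf hz 1
    have h2 := IsFrameOn.conn_sub_conn h.metric hz e 0 1 1
    rw [hfr.conn_self h.metric hz] at h2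
    simp only [Fin.castSucc_one, one_ne_zero, if_false, if_true, ← he, ← hL] at h1
    linarith
  have hd := fun {g : E 3 → ℝ} (hg : ContDiffOn ℝ ∞ g O) => differentiableAt_of_contDiffOn hO hg hy
  have hconn : ∀ a b c, ContDiffOn ℝ ∞ (conn B e a b c) O := fun a b c =>
    hfr.contDiffOn_conn h.metric a b c
  have hstr : ∀ i, ContDiffOn ℝ ∞ (struc H f 0 1 i) O' := fun i => by
    refine ((hf.contDiffOn_conn h.metric' 0 1 i).sub (hf.contDiffOn_conn h.metric' 1 0 i)).congr
      fun z hz => (IsFrameOn.conn_sub_conn h.metric' hz f 0 1 i).symm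
  have hprod : ∀ i u, fderiv ℝ (fun z => lam z * struc H f 0 1 i (F z)) y u =
      lam y * fderiv ℝ (struc H f 0 1 i) (F y) (fderiv ℝ F y u)
        + lam y * fderiv ℝ L y u * struc H f 0 1 i (F y) := fun i u => by
    have hs := differentiableAt_of_contDiffOn h.metric'.isOpen (hstr i) (h.mapsTo y hy)
    have hF := differentiableAt_of_contDiffOn hO h.contDiffOn hy
    have h1 := ((hd h.contDiffOn_dilation).hasFDerivAt.mul
      (hs.hasFDerivAt.comp y hF.hasFDerivAt)).fderiv
    change fderiv ℝ ((fun z => lam z) * fun z => struc H f 0 1 i (F z)) y u = _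
    simp only [Function.comp_def] at h1
    rw [h1, hL, h.fderiv_log_dilation hy]
    have h0 := (h.pos y hy).ne'
    simp
    field_simp
  have hF0 : fderiv ℝ F y (e 0 y) = lam y • f 0 (F y) := he ▸ h.fderiv_scaledLift hy (f 0)
  have hF1 : fderiv ℝ F y (e 1 y) = lam y • f 1 (F y) := he ▸ h.fderiv_scaledLift hy (f 1)
  have hA := hprod 0 (e 1 y)
  have hB := hprod 1 (e 0 y)
  rw [fderiv_congr_on hO ha hy, fderiv_fun_sub (hd (hdL 1)) (hd (hconn 0 0 1)), hF1] at hA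
  rw [fderiv_congr_on hO hb hy, fderiv_fun_sub (hd (hconn 1 0 1)).fun_neg (hd (hdL 0)),
    fderiv_fun_neg, hF0] at hB
  simp only [sub_apply, neg_apply, map_smul, smul_eq_mul] at hA hB
  have ha' := ha y hy
  have hb' := hb y hy
  rw [hf.gaussCurvature_eq_struc h.metric' (h.mapsTo y hy)]
  -- The single multiples of `ha'` and `hb'` rewrite the terms where `λ` was differentiated; the
  -- last two are differences of squares.
  linear_combination hA - hB - fderiv ℝ L y (e 0 y) * hb' + fderiv ℝ L y (e 1 y) * ha'
    - (lam y * struc H f 0 1 0 (F y) + (fderiv ℝ L y (e 1 y) - conn B e 0 0 1 y)) * ha'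
    - (lam y * struc H f 0 1 1 (F y) + (- conn B e 1 0 1 y - fderiv ℝ L y (e 0 y))) * hb'

end IsLocalSubmersion

/-! ### The Ricci formula on open sets -/

namespace IsLocalSubmersion

variable {B : E 3 → E 3 →L[ℝ] E 3 →L[ℝ] ℝ} {O : Set (E 3)}
  {H : E 2 → E 2 →L[ℝ] E 2 →L[ℝ] ℝ} {O' : Set (E 2)} {F : E 3 → E 2} {lam : E 3 → ℝ}
  {V : E 3 → E 3} {y : E 3}

theorem ricci_eq (h : IsLocalSubmersion B O H O' F lam V) (hy : y ∈ O) {L : E 3 → ℝ}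
    (hL : L = fun z => Real.log (lam z)) (u v : E 3) :
    ricci (toForm B) y u v =
      (lam y ^ 2 * gaussCurvature (toForm H) (F y) + laplacian (toForm B) L y
          + dirDeriv (meanCurvature (toForm B) V) L y)
          * (toForm B y u v - flat (toForm B) V y u * flat (toForm B) V y v)
        - 1 / 4 * integrabilityNormSq (toForm B) V y * toForm B y u v
        + 1 / 2 * lieDerivMetric (toForm B) (meanCurvature (toForm B) V) y u v
        - (flat (toForm B) (meanCurvature (toForm B) V) y u
            + dirDeriv V L y * flat (toForm B) V y u)
          * (flat (toForm B) (meanCurvature (toForm B) V) y v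
            + dirDeriv V L y * flat (toForm B) V y v)
        - (dirDeriv V L y * flat (toForm B) V y u) * (dirDeriv V L y * flat (toForm B) V y v)
        + 2 * (1 / 2 * (fderiv ℝ (dirDeriv V L) y u * flat (toForm B) V y v
            + flat (toForm B) V y u * fderiv ℝ (dirDeriv V L) y v))
        + 1 / 2 * (codiff (toForm B) (extDeriv (flat (toForm B) V)) y u * flat (toForm B) V y v
          + flat (toForm B) V y u * codiff (toForm B) (extDeriv (flat (toForm B) V)) y v) := by
  obtain ⟨f, hf⟩ := h.metric'.exists_frame
  obtain ⟨e, he⟩ : ∃ e, e = frame B H F lam V f := ⟨_, rfl⟩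
  have hB := h.metric
  have hO := hB.isOpen
  have hV := h.contDiffOn_field
  have hfr := h.isFrameOn hf
  have hon := hfr.orthonormal y hy
  rw [← he] at hfr hon
  have he2 : V = e 2 := by rw [he]; rfl
  have hLs : ContDiffOn ℝ ∞ L O := hL ▸ h.contDiffOn_log_dilation
  have hconn : ∀ a b c, DifferentiableAt ℝ (conn B e a b c) y := fun a b c =>
    differentiableAt_of_contDiffOn hO (hfr.contDiffOn_conn hB a b c) hy
  -- the mean curvature field
  set μ := meanCurvature (toForm B) V with hμ
  have hμe : ∀ z ∈ O, μ z = nabla B (e 2) z (e 2 z) := fun z hz => by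
    rw [hμ, hB.meanCurvature_eq hz hV h.unit, he2]
  have hμs : ContDiffOn ℝ ∞ μ O :=
    (hB.contDiffOn_nabla (hfr.contDiffOn 2) (hfr.contDiffOn 2)).congr hμe
  have hμc : ∀ z ∈ O, ∀ a, B z (μ z) (e a z) = conn B e 2 2 a z := fun z hz a => by
    rw [hμe z hz, conn]
  have hμL : dirDeriv μ L y = ∑ a, conn B e 2 2 a y * fderiv ℝ L y (e a y) := by
    rw [dirDeriv, ← IsMetricOn.sum_apply_smul hon (μ y)]
    simp [hμc y hy]
  have hμn : ∀ a b, B y (nabla B μ y (e a y)) (e b y) =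
      fderiv ℝ (conn B e 2 2 b) y (e a y) - ∑ f, conn B e 2 2 f y * conn B e a b f y :=
    fun a b => by
      rw [hfr.apply_nabla hB hy hμs, fderiv_congr_on hO (fun z hz => hμc z hz b) hy]
      simp only [hμc y hy]
  have hμn' : ∀ a b, B y (e b y) (nabla B μ y (e a y)) =
      fderiv ℝ (conn B e 2 2 b) y (e a y) - ∑ f, conn B e 2 2 f y * conn B e a b f y :=
    fun a b => by rw [hB.symm y hy, hμn]
  -- the exterior derivative of `θ`
  have hΩs := hB.contDiffOn_dFlat hV
  have hΩ : ∀ z ∈ O, ∀ a b, dFlat B V z (e a z) (e b z) = conn B e a 2 b z - conn B e b 2 a z :=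
    fun z hz a b => by rw [dFlat_apply, he2, conn, conn]
  have hcod : ∀ c, codiff (toForm B) (toForm (dFlat B V)) y (e c y) =
      - ∑ a, (fderiv ℝ (conn B e a 2 c) y (e a y) - fderiv ℝ (conn B e c 2 a) y (e a y)
        - ∑ f, (conn B e a a f y * (conn B e f 2 c y - conn B e c 2 f y)
          + conn B e a c f y * (conn B e a 2 f y - conn B e f 2 a y))) := fun c => by
    rw [hfr.codiff_eq hB hy hΩs]
    simp only [hΩ y hy]
    refine congrArg _ (Finset.sum_congr rfl fun a _ => ?_)
    rw [fderiv_congr_on hO (fun z hz => hΩ z hz a c) hy, fderiv_fun_sub (hconn _ _ _) (hconn _ _ _),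
      sub_apply]
  -- the dilation
  have hVLz : ∀ z ∈ O, fderiv ℝ L z (e 2 z) = conn B e 0 0 2 z := fun z hz => by
    rw [hL, he, h.conn_002 hf hz]; rfl
  have hVL : dirDeriv V L y = conn B e 0 0 2 y := by rw [dirDeriv, he2, hVLz y hy]
  have hdVL : fderiv ℝ (dirDeriv V L) y = fderiv ℝ (conn B e 0 0 2) y := by
    refine fderiv_congr_on hO (fun z hz => ?_) hy
    rw [dirDeriv, he2, hVLz z hz]
  have hddL : fderiv ℝ (fun z => fderiv ℝ L z (e 2 z)) y = fderiv ℝ (conn B e 0 0 2) y :=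
    fderiv_congr_on hO hVLz hy
  have hK := h.dilation_sq_mul_gaussCurvature hf hy he hL
  -- the connection coefficients
  have c112 : ∀ z ∈ O, conn B e 1 1 2 z = conn B e 0 0 2 z := fun z hz => by
    rw [he]; exact h.conn_112 hf hz
  have c201 : ∀ z ∈ O, conn B e 2 0 1 z = - conn B e 0 1 2 z := fun z hz => by
    rw [he]; exact h.conn_201 hf hz
  have c102 : ∀ z ∈ O, conn B e 1 0 2 z = - conn B e 0 1 2 z := fun z hz => by
    rw [he]; exact h.conn_102 hf hz
  have d112 := fderiv_congr_on hO c112 hy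
  have d201 := fderiv_congr_on hO c201 hy
  have d102 := fderiv_congr_on hO c102 hy
  rw [fderiv_fun_neg] at d201 d102
  replace c112 := c112 y hy
  replace c201 := c201 y hy
  replace c102 := c102 y hy
  have c0 := hfr.conn_self hB hy
  have d0 : ∀ a b, fderiv ℝ (conn B e a b b) y = 0 := fun a b => by
    rw [fderiv_congr_on hO (fun z hz => hfr.conn_self hB hz a b) hy, fderiv_fun_const]
    rfl
  have s10 := fun a => hfr.conn_skew hB hy a 0 1
  have s20 := fun a => hfr.conn_skew hB hy a 0 2
  have s21 := fun a => hfr.conn_skew hB hy a 1 2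
  have t10 := fun a => hfr.fderiv_conn_skew hB hy a 0 1
  have t20 := fun a => hfr.fderiv_conn_skew hB hy a 0 2
  have t21 := fun a => hfr.fderiv_conn_skew hB hy a 1 2
  have hlap := hfr.laplacian_eq hB hy hLs
  have hI := hB.integrabilityNormSq_eq hy hV h.unit hon
  -- `|I(e 0, e 1)| = 2 |conn 0 1 2|`, and both ordered pairs count: `2 · 2² = 8`.
  have hI' : integrabilityNormSq (toForm B) V y = 8 * conn B e 0 1 2 y ^ 2 := by
    have hp : ∀ a, e a y - B y (e a y) (e 2 y) • e 2 y = if a = 2 then 0 else e a y := fun a => by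
      rw [hon]
      split_ifs with ha
      · rw [ha, one_smul, sub_self]
      · rw [zero_smul, sub_zero]
    have hz : ∀ a, dFlat B V y (e a y) (e a y) = 0 := fun a => by rw [hΩ y hy]; ring
    have h01 : dFlat B V y (e 0 y) (e 1 y) = - 2 * conn B e 0 1 2 y := by
      rw [hΩ y hy, s21, s20, c102]; ring
    have h10 : dFlat B V y (e 1 y) (e 0 y) = 2 * conn B e 0 1 2 y := by
      rw [hΩ y hy, s21, s20, c102]; ring
    rw [hI, show V y = e 2 y by rw [he2]]
    simp only [hp, Fin.sum_univ_three, if_true, if_false, show (0 : Fin 3) ≠ 2 by decide,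
      show (1 : Fin 3) ≠ 2 by decide, hz, h01, h10, map_zero, zero_apply]
    ring
  have hR := hfr.riem_frame hB hy
  have hst : ∀ a b c, struc B e a b c y = conn B e a b c y - conn B e b a c y := fun a b c =>
    (IsFrameOn.conn_sub_conn hB hy e a b c).symm
  -- Once expanded in connection coefficients, these components of the Bianchi identity are exactly
  -- the relations making Ricci symmetric.
  have hJ : ∀ d, B y (riem B y (e 0 y) (e 1 y) (e 2 y)) (e d y)
      + B y (riem B y (e 1 y) (e 2 y) (e 0 y)) (e d y)
      + B y (riem B y (e 2 y) (e 0 y) (e 1 y)) (e d y) = 0 := fun d => by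
    rw [← add_apply, ← add_apply, ← map_add, ← map_add, hB.riem_bianchi hy]
    simp
  have J0 := hJ 0
  have J1 := hJ 1
  have J2 := hJ 2
  rw [hB.codiff_extDeriv_flat hy hV]
  simp only [hB.lieDerivMetric_eq hy]
  have hcl := hB.isLinearMap_codiff hy (differentiableAt_of_contDiffOn hO hΩs hy)
  revert u v
  refine IsMetricOn.ext_bilin hon (hB.isLinearMap_ricci_left hy) (hB.isLinearMap_ricci_right hy)
    ?_ ?_ ?_
  · refine fun w => ⟨fun a b => ?_, fun c a => ?_⟩
    · simp only [flat, toForm, map_add, add_apply, hcl.map_add]; ring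
    · simp only [flat, toForm, map_smul, smul_apply, hcl.map_smul, smul_eq_mul]; ring
  · refine fun w => ⟨fun a b => ?_, fun c a => ?_⟩
    · simp only [flat, toForm, map_add, hcl.map_add]; ring
    · simp only [flat, toForm, map_smul, hcl.map_smul, smul_eq_mul]; ring
  intro a b
  simp only [flat, toForm, hμc y hy, hμn, hμn', hcod, hVL, hdVL, hK, hI', hlap, hμL]
  rw [he2, hB.ricci_eq hy hon]
  simp only [hon]
  simp only [Fin.sum_univ_three, hR, hst, hddL, hVLz y hy] at J0 J1 J2 ⊢
  -- The right side at `(0, 1)` is the symmetrised Ricci component, whence the correction `± J2 / 2`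
  -- there and at `(1, 0)`. Columns `(0, 2)`, `(1, 2)` are polynomial identities, and their
  -- transposes cost a full `J1` or `J0`.
  fin_cases a <;> fin_cases b <;>
  simp only [Fin.zero_eta, Fin.mk_one, Fin.reduceFinMk] <;>
  simp only [s10, s20, s21, t10, t20, t21, c0, d0, c112, c201, c102, d112, d201, d102,
    neg_apply, zero_apply, if_true, if_false, show (0 : Fin 3) ≠ 1 by decide,
    show (0 : Fin 3) ≠ 2 by decide, show (1 : Fin 3) ≠ 2 by decide,
    show (1 : Fin 3) ≠ 0 by decide, show (2 : Fin 3) ≠ 0 by decide,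
    show (2 : Fin 3) ≠ 1 by decide] at J0 J1 J2 ⊢
  · ring
  · linear_combination J2 / 2
  · ring
  · linear_combination - J2 / 2
  · ring
  · ring
  · linear_combination J1
  · linear_combination - J0
  · ring

end IsLocalSubmersion

/-! ### Metrics and vector fields read in charts -/

section Charts

variable {n : ℕ} {M : Type*} [TopologicalSpace M] [ChartedSpace (E n) M]
  {e : OpenPartialHomeomorph M (E n)}

theorem mdifferentiable_of_mem_maximalAtlas
    (he : e ∈ IsManifold.maximalAtlas 𝓘(ℝ, E n) ∞ M) :
    e.MDifferentiable 𝓘(ℝ, E n) 𝓘(ℝ, E n) :=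
  ⟨(contMDiffOn_of_mem_maximalAtlas he).mdifferentiableOn (by simp),
    (contMDiffOn_symm_of_mem_maximalAtlas he).mdifferentiableOn (by simp)⟩

theorem isInvertible_mfderiv_symm (he : e ∈ IsManifold.maximalAtlas 𝓘(ℝ, E n) ∞ M) {z : E n}
    (hz : z ∈ e.target) : (mfderiv 𝓘(ℝ, E n) 𝓘(ℝ, E n) e.symm z).IsInvertible :=
  ⟨(mdifferentiable_of_mem_maximalAtlas he).symm.mfderiv hz, rfl⟩

theorem mfderiv_symm_fieldInChart (he : e ∈ IsManifold.maximalAtlas 𝓘(ℝ, E n) ∞ M)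
    (U : ∀ x : M, TangentSpace 𝓘(ℝ, E n) x) {z : E n} (hz : z ∈ e.target) :
    mfderiv 𝓘(ℝ, E n) 𝓘(ℝ, E n) e.symm z (fieldInChart e U z) = U (e.symm z) :=
  (isInvertible_mfderiv_symm he hz).self_apply_inverse _

variable [IsManifold 𝓘(ℝ, E n) ∞ M]

/-- The metric read in a chart, as a field of continuous bilinear forms. -/
def chartMetric (g : Metric n M) (e : OpenPartialHomeomorph M (E n)) (y : E n) :
    E n →L[ℝ] E n →L[ℝ] ℝ :=
  ContinuousLinearMap.bilinearComp (E := E n) (F := E n)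
    (g.inner (e.symm y) : E n →L[ℝ] E n →L[ℝ] ℝ)
    (mfderiv 𝓘(ℝ, E n) 𝓘(ℝ, E n) e.symm y : E n →L[ℝ] E n)
    (mfderiv 𝓘(ℝ, E n) 𝓘(ℝ, E n) e.symm y : E n →L[ℝ] E n)

/-- The tangent map of the smooth map `e.symm` composed with a constant section. -/
theorem contMDiffOn_mfderiv_symm (he : e ∈ IsManifold.maximalAtlas 𝓘(ℝ, E n) ∞ M) (u : E n) :
    ContMDiffOn 𝓘(ℝ, E n) 𝓘(ℝ, E n).tangent ∞
      (fun z => (⟨e.symm z, mfderiv 𝓘(ℝ, E n) 𝓘(ℝ, E n) e.symm z u⟩ : TangentBundle 𝓘(ℝ, E n) M))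
      e.target := by
  have h1 := (contMDiffOn_symm_of_mem_maximalAtlas he).contMDiffOn_tangentMapWithin
    (m := ∞) (by simp) e.open_target.uniqueMDiffOn
  have h2 : ContMDiffOn 𝓘(ℝ, E n) 𝓘(ℝ, E n).tangent ∞
      (fun z => (⟨z, u⟩ : TangentBundle 𝓘(ℝ, E n) (E n))) e.target :=
    contMDiffOn_vectorSpace_iff_contDiffOn.2 contDiffOn_const
  refine (h1.comp h2 fun z hz => hz).congr fun z hz => ?_
  simp only [Function.comp, tangentMapWithin, mfderivWithin_of_isOpen e.open_target hz]

theorem contDiffOn_chartMetric (g : Metric n M)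
    (he : e ∈ IsManifold.maximalAtlas 𝓘(ℝ, E n) ∞ M) :
    ContDiffOn ℝ ∞ (chartMetric g e) e.target := by
  refine contDiffOn_clm_apply.2 fun u => contDiffOn_clm_apply.2 fun v => ?_
  have hs := contMDiffOn_symm_of_mem_maximalAtlas he
  have hg := g.contMDiff.comp_contMDiffOn hs
  have := ContMDiffOn.clm_bundle_apply₂ (F₁ := E n) (F₂ := E n) (F₃ := ℝ)
    (E₃ := Bundle.Trivial M ℝ) hg (contMDiffOn_mfderiv_symm he u) (contMDiffOn_mfderiv_symm he v)
  intro z hz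
  have h2 := this z hz
  rw [Bundle.contMDiffWithinAt_totalSpace] at h2
  exact h2.2.contDiffWithinAt

theorem isMetricOn_chartMetric (g : Metric n M)
    (he : e ∈ IsManifold.maximalAtlas 𝓘(ℝ, E n) ∞ M) :
    IsMetricOn (chartMetric g e) e.target where
  isOpen := e.open_target
  contDiffOn := contDiffOn_chartMetric g he
  symm y _ u v := g.symm (e.symm y) (mfderiv 𝓘(ℝ, E n) 𝓘(ℝ, E n) e.symm y u)
    (mfderiv 𝓘(ℝ, E n) 𝓘(ℝ, E n) e.symm y v)
  pos y hy u hu := by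
    refine g.pos (e.symm y) (mfderiv 𝓘(ℝ, E n) 𝓘(ℝ, E n) e.symm y u) fun h0 => hu ?_
    refine (mdifferentiable_of_mem_maximalAtlas he).symm.mfderiv_injective hy ?_
    exact h0.trans (map_zero (mfderiv 𝓘(ℝ, E n) 𝓘(ℝ, E n) e.symm y)).symm

theorem IsMetricOn.mono {B : E n → E n →L[ℝ] E n →L[ℝ] ℝ} {O O' : Set (E n)}
    (hB : IsMetricOn B O) (hO : IsOpen O') (h : O' ⊆ O) : IsMetricOn B O' :=
  ⟨hO, hB.contDiffOn.mono h, fun y hy => hB.symm y (h hy), fun y hy => hB.pos y (h hy)⟩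

theorem contDiffOn_fieldInChart (he : e ∈ IsManifold.maximalAtlas 𝓘(ℝ, E n) ∞ M)
    {U : ∀ x : M, TangentSpace 𝓘(ℝ, E n) x} {W : Set M} (hW : IsOpen W)
    (hU : ContMDiffOn 𝓘(ℝ, E n) 𝓘(ℝ, E n).tangent ∞
      (fun x => (⟨x, U x⟩ : TangentBundle 𝓘(ℝ, E n) M)) W) :
    ContDiffOn ℝ ∞ (fieldInChart e U) (e.target ∩ e.symm ⁻¹' W) := by
  intro z hz
  have h := ContMDiffAt.mpullback_vectorField_preimage (f := e.symm) (V := U) (x₀ := z) (m := ∞)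
    (n := ∞) (hU.contMDiffAt (hW.mem_nhds hz.2))
    (contMDiffAt_symm_of_mem_maximalAtlas he hz.1) (isInvertible_mfderiv_symm he hz.1) (by simp)
  exact (contMDiffAt_vectorSpace_iff_contDiffAt.1 h).contDiffWithinAt

end Charts

/-! ### A semi-conformal submersion read in charts, and the conclusion -/

section Submersion

variable {M : Type*} [TopologicalSpace M] [ChartedSpace (E 3) M]
  {N : Type*} [TopologicalSpace N] [ChartedSpace (E 2) N] {φ : M → N} {lam : M → ℝ}
  {e : OpenPartialHomeomorph M (E 3)} {e' : OpenPartialHomeomorph N (E 2)}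

/-- The chain rule for the expression of a map in charts. -/
theorem mfderiv_symm_fderiv_chart (hφ : ContMDiff 𝓘(ℝ, E 3) 𝓘(ℝ, E 2) ∞ φ)
    (he : e ∈ IsManifold.maximalAtlas 𝓘(ℝ, E 3) ∞ M)
    (he' : e' ∈ IsManifold.maximalAtlas 𝓘(ℝ, E 2) ∞ N) {O : Set (E 3)} (hO : IsOpen O)
    (hOe : O ⊆ e.target) (hOe' : ∀ z ∈ O, φ (e.symm z) ∈ e'.source)
    (hF : ContDiffOn ℝ ∞ (fun z => e' (φ (e.symm z))) O) {z : E 3} (hz : z ∈ O) (u : E 3) :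
    (mfderiv 𝓘(ℝ, E 2) 𝓘(ℝ, E 2) e'.symm (e' (φ (e.symm z)))
        (fderiv ℝ (fun z => e' (φ (e.symm z))) z u) : E 2) =
      mfderiv 𝓘(ℝ, E 3) 𝓘(ℝ, E 2) φ (e.symm z) (mfderiv 𝓘(ℝ, E 3) 𝓘(ℝ, E 3) e.symm z u) := by
  have hE := (mdifferentiable_of_mem_maximalAtlas he).symm.mdifferentiableAt (hOe hz)
  have hE' := (mdifferentiable_of_mem_maximalAtlas he').symm.mdifferentiableAt
    (e'.map_source (hOe' z hz))
  have hd : MDifferentiableAt 𝓘(ℝ, E 3) 𝓘(ℝ, E 2) (fun z => e' (φ (e.symm z))) z :=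
    (differentiableAt_of_contDiffOn hO hF hz).mdifferentiableAt
  have hφ' : MDifferentiableAt 𝓘(ℝ, E 3) 𝓘(ℝ, E 2) φ (e.symm z) :=
    hφ.mdifferentiable (by simp) _
  have heq : (e'.symm ∘ fun z => e' (φ (e.symm z))) =ᶠ[nhds z] φ ∘ e.symm :=
    Filter.eventually_of_mem (hO.mem_nhds hz) fun w hw => e'.left_inv (hOe' w hw)
  have h1 := mfderiv_comp z hE' hd
  have h2 := mfderiv_comp z hφ' hE
  have h3 := heq.mfderiv_eq (I := 𝓘(ℝ, E 3)) (I' := 𝓘(ℝ, E 2))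
  have h4 : (mfderiv 𝓘(ℝ, E 3) 𝓘(ℝ, E 2) (e'.symm ∘ fun z => e' (φ (e.symm z))) z u : E 2) =
      mfderiv 𝓘(ℝ, E 3) 𝓘(ℝ, E 2) (φ ∘ e.symm) z u :=
    congrArg (fun T : E 3 →L[ℝ] E 2 => T u) h3
  rw [h1, h2] at h4
  rw [← mfderiv_eq_fderiv]
  exact h4

variable [IsManifold 𝓘(ℝ, E 3) ∞ M] [IsManifold 𝓘(ℝ, E 2) ∞ N] {g : Metric 3 M} {h : Metric 2 N}

/-- By rank–nullity the kernel has dimension `3 - 2 = 1`, so `U` spans it. This matches the two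
notions of horizontality: orthogonal to the kernel, and orthogonal to `U`. -/
theorem IsSemiConformalSubmersion.inner_eq_zero_of_vertical
    (hφ : IsSemiConformalSubmersion g h φ lam) {x : M} {U X : TangentSpace 𝓘(ℝ, E 3) x}
    (hU : mfderiv 𝓘(ℝ, E 3) 𝓘(ℝ, E 2) φ x U = 0) (h1 : g.inner x U U = 1)
    (hX : g.inner x X U = 0) (Z : TangentSpace 𝓘(ℝ, E 3) x)
    (hZ : mfderiv 𝓘(ℝ, E 3) 𝓘(ℝ, E 2) φ x Z = 0) : g.inner x X Z = 0 := by
  let T : E 3 →L[ℝ] E 2 := mfderiv 𝓘(ℝ, E 3) 𝓘(ℝ, E 2) φ x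
  have hr : Module.finrank ℝ (LinearMap.ker T.toLinearMap) = 1 := by
    have h2 := T.toLinearMap.finrank_range_add_finrank_ker
    have h3 : LinearMap.range T.toLinearMap = ⊤ := LinearMap.range_eq_top.2 (hφ.surjective x)
    rw [h3, finrank_top] at h2
    simp only [finrank_euclideanSpace, Fintype.card_fin] at h2
    omega
  let U' : LinearMap.ker T.toLinearMap := ⟨U, hU⟩
  have hU0 : U' ≠ 0 := fun h0 => by
    have h2 : U = (0 : TangentSpace 𝓘(ℝ, E 3) x) := congrArg Subtype.val h0
    rw [h2, map_zero] at h1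
    exact zero_ne_one h1
  obtain ⟨c, hc⟩ := (finrank_eq_one_iff_of_nonzero' U' hU0).1 hr ⟨Z, hZ⟩
  have hc' : c • U = Z := congrArg Subtype.val hc
  rw [← hc', map_smul, hX, smul_zero]

theorem IsSemiConformalSubmersion.isLocalSubmersion (hφ : IsSemiConformalSubmersion g h φ lam)
    {W : Set M} (hW : IsOpen W) {U : ∀ x : M, TangentSpace 𝓘(ℝ, E 3) x}
    (hU : IsUnitVerticalOn (m := 2) g φ U W)
    (he : e ∈ IsManifold.maximalAtlas 𝓘(ℝ, E 3) ∞ M)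
    (he' : e' ∈ IsManifold.maximalAtlas 𝓘(ℝ, E 2) ∞ N) :
    IsLocalSubmersion (chartMetric g e) (e.target ∩ e.symm ⁻¹' (W ∩ φ ⁻¹' e'.source))
      (chartMetric h e') e'.target (fun z => e' (φ (e.symm z))) (fun z => lam (e.symm z))
      (fieldInChart e U) := by
  set O := e.target ∩ e.symm ⁻¹' (W ∩ φ ⁻¹' e'.source) with hOdef
  have hcont : Continuous φ := hφ.contMDiff.continuous
  have hO : IsOpen O := e.symm.isOpen_inter_preimage (hW.inter (e'.open_source.preimage hcont))
  have hOe : O ⊆ e.target := fun z hz => hz.1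
  have hOe' : ∀ z ∈ O, φ (e.symm z) ∈ e'.source := fun z hz => hz.2.2
  have hF : ContDiffOn ℝ ∞ (fun z => e' (φ (e.symm z))) O := by
    refine ContMDiffOn.contDiffOn ?_
    exact (contMDiffOn_of_mem_maximalAtlas he').comp
      (hφ.contMDiff.comp_contMDiffOn ((contMDiffOn_symm_of_mem_maximalAtlas he).mono hOe)) hOe'
  have hch := fun {z : E 3} (hz : z ∈ O) (u : E 3) =>
    mfderiv_symm_fderiv_chart hφ.contMDiff he he' hO hOe hOe' hF hz u
  have hV : ∀ z ∈ O, (mfderiv 𝓘(ℝ, E 3) 𝓘(ℝ, E 3) e.symm z (fieldInChart e U z) : E 3) =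
      U (e.symm z) := fun z hz => mfderiv_symm_fieldInChart he U (hOe hz)
  have hinj : ∀ z ∈ O, Function.Injective
      (mfderiv 𝓘(ℝ, E 2) 𝓘(ℝ, E 2) e'.symm (e' (φ (e.symm z))) : E 2 → E 2) := fun z hz =>
    (mdifferentiable_of_mem_maximalAtlas he').symm.mfderiv_injective (e'.map_source (hOe' z hz))
  have hsurj : ∀ z ∈ O, Function.Surjective
      (mfderiv 𝓘(ℝ, E 3) 𝓘(ℝ, E 3) e.symm z : E 3 → E 3) := fun z hz =>
    (mdifferentiable_of_mem_maximalAtlas he).symm.mfderiv_surjective (hOe hz)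
  have hunit : ∀ z ∈ O, chartMetric g e z (fieldInChart e U z) (fieldInChart e U z) = 1 :=
    fun z hz => by
      have h1 := hU.unit (e.symm z) hz.2.1
      change g.inner (e.symm z) (mfderiv 𝓘(ℝ, E 3) 𝓘(ℝ, E 3) e.symm z (fieldInChart e U z))
        (mfderiv 𝓘(ℝ, E 3) 𝓘(ℝ, E 3) e.symm z (fieldInChart e U z)) = 1
      rw [mfderiv_symm_fieldInChart he U (hOe hz)]
      exact h1
  refine ⟨(isMetricOn_chartMetric g he).mono hO hOe, isMetricOn_chartMetric h he',
    fun z hz => e'.map_source (hOe' z hz), hF,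
    (contDiffOn_fieldInChart he hW hU.contMDiffOn).mono fun z hz => ⟨hz.1, hz.2.1⟩,
    fun z hz w => ?_, fun z _ => hφ.dilation_pos _, fun z hz => ?_, hunit, fun z hz u v hu hv => ?_⟩
  · obtain ⟨X, hX⟩ := hφ.surjective (e.symm z)
      (mfderiv 𝓘(ℝ, E 2) 𝓘(ℝ, E 2) e'.symm (e' (φ (e.symm z))) w : E 2)
    obtain ⟨u, rfl⟩ := hsurj z hz X
    exact ⟨u, hinj z hz ((hch hz u).trans hX)⟩
  · refine hinj z hz ((hch hz _).trans ?_)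
    have h1 := hU.vertical (e.symm z) hz.2.1
    refine Eq.trans ?_ (h1.trans
      (map_zero (mfderiv 𝓘(ℝ, E 2) 𝓘(ℝ, E 2) e'.symm (e' (φ (e.symm z))))).symm)
    exact congrArg (mfderiv 𝓘(ℝ, E 3) 𝓘(ℝ, E 2) φ (e.symm z) : E 3 → E 2) (hV z hz)
  · have hvert := hU.vertical (e.symm z) hz.2.1
    have h1 := hU.unit (e.symm z) hz.2.1
    have hperp : ∀ u : E 3, chartMetric g e z u (fieldInChart e U z) = 0 →
        g.inner (e.symm z) (mfderiv 𝓘(ℝ, E 3) 𝓘(ℝ, E 3) e.symm z u) (U (e.symm z)) = 0 :=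
      fun u hu => by
        rw [← mfderiv_symm_fieldInChart he U (hOe hz)]
        exact hu
    have h2 := hφ.conformal (e.symm z) _ _
      (hφ.inner_eq_zero_of_vertical hvert h1 (hperp u hu))
      (hφ.inner_eq_zero_of_vertical hvert h1 (hperp v hv))
    -- `h` must be moved from `φ (e.symm z)` to the equal point `e'.symm (e' (φ (e.symm z)))`, with
    -- tangent vectors at both regarded in `E 2`.
    have h3 : ∀ p q : N, p = q → ∀ a b : E 2, (h.inner p : E 2 →L[ℝ] E 2 →L[ℝ] ℝ) a b =
        (h.inner q : E 2 →L[ℝ] E 2 →L[ℝ] ℝ) a b := by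
      rintro p _ rfl a b
      rfl
    refine h2.trans ((h3 _ _ (e'.left_inv (hOe' z hz)).symm _ _).trans ?_)
    rw [← hch hz u, ← hch hz v]
    rfl

end Submersion

end SemiConformal

end

theorem mainTheorem4
    {M : Type*} [TopologicalSpace M] [ChartedSpace (SemiConformal.E 3) M]
    [IsManifold 𝓘(ℝ, SemiConformal.E 3) ∞ M]
    {N : Type*} [TopologicalSpace N] [ChartedSpace (SemiConformal.E 2) N]
    [IsManifold 𝓘(ℝ, SemiConformal.E 2) ∞ N]
    (g : SemiConformal.Metric 3 M) (h : SemiConformal.Metric 2 N)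
    (φ : M → N) (lam : M → ℝ)
    (hφ : SemiConformal.IsSemiConformalSubmersion g h φ lam)
    -- a choice of unit vertical vector field on an open set
    (W : Set M) (hW : IsOpen W) (U : ∀ x : M, TangentSpace 𝓘(ℝ, SemiConformal.E 3) x)
    (hU : SemiConformal.IsUnitVerticalOn (m := 2) g φ U W)
    -- a point, and arbitrary smooth charts around it and around its image
    (x : M) (hx : x ∈ W)
    (e : OpenPartialHomeomorph M (SemiConformal.E 3))
    (he : e ∈ IsManifold.maximalAtlas 𝓘(ℝ, SemiConformal.E 3) ∞ M) (hxe : x ∈ e.source)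
    (e' : OpenPartialHomeomorph N (SemiConformal.E 2))
    (he' : e' ∈ IsManifold.maximalAtlas 𝓘(ℝ, SemiConformal.E 2) ∞ N) (hxe' : φ x ∈ e'.source) :
    -- the metric, the field `U`, the function `ln λ`, the forms `θ` and `Ω = dθ`, and the fields
    -- `μ` and `U(ln λ)` in the chart `e`
    let y : SemiConformal.E 3 := e x
    let G := SemiConformal.metricInChart g e
    let V := SemiConformal.fieldInChart e U
    let L : SemiConformal.E 3 → ℝ := fun z => Real.log (lam (e.symm z))
    let θ := SemiConformal.flat G V
    let Ω := SemiConformal.extDeriv θ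
    let μ := SemiConformal.meanCurvature G V
    let VL := SemiConformal.dirDeriv V L
    let K := SemiConformal.gaussCurvature (SemiConformal.metricInChart h e') (e' (φ x))
    ∀ u v : SemiConformal.E 3,
      SemiConformal.ricci G y u v =
        (lam x ^ 2 * K + SemiConformal.laplacian G L y + SemiConformal.dirDeriv μ L y)
            * (G y u v - θ y u * θ y v)
          - 1 / 4 * SemiConformal.integrabilityNormSq G V y * G y u v
          + 1 / 2 * SemiConformal.lieDerivMetric G μ y u v
          - (SemiConformal.flat G μ y u + VL y * θ y u)
            * (SemiConformal.flat G μ y v + VL y * θ y v)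
          - (VL y * θ y u) * (VL y * θ y v)
          + 2 * (1 / 2 * (fderiv ℝ VL y u * θ y v + θ y u * fderiv ℝ VL y v))
          + 1 / 2 * (SemiConformal.codiff G Ω y u * θ y v
            + θ y u * SemiConformal.codiff G Ω y v) := by
  intro y G V L θ Ω μ VL K u v
  have hloc := hφ.isLocalSubmersion hW hU he he'
  have hl : e.symm y = x := e.left_inv hxe
  have hy : y ∈ e.target ∩ e.symm ⁻¹' (W ∩ φ ⁻¹' e'.source) :=
    ⟨e.map_source hxe, by rw [Set.mem_preimage, hl]; exact ⟨hx, hxe'⟩⟩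
  have key := hloc.ricci_eq hy (L := L) rfl u v
  -- Only `lam` and `K` at the point mention `e.symm y`; `chartMetric` and `metricInChart` agree by
  -- unfolding.
  simp only [hl] at key
  exact key
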